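/- Let $n,m,r,q,p\ge 0$ be integers, let $M\subseteq\mathbb R^n\times\mathbb R^m$ be open (the space of the independent variables $x$ and dependent variables $u$), let $E\subseteq\mathbb R$ be an open set containing $0$, and let $\Omega$ be an open subset of the part over $M$ of the $r$-th jet space, whose coordinates are $x_i$ and $u_{\alpha,J}$ ($1\le\alpha\le m$, $J$ an unordered multi-index in $\{1,\dots,n\}$, $|J|\le r$). Consider a differential equation (or a system of $q$ equations) $\Delta(x,u,u^{(r)};\varepsilon)=0$ with $\Delta:\Omega\times E\to\mathbb R^q$ of class $C^\infty$, and assume that the unperturbed equation has maximal rank: at every point of $\Omega$ with $\Delta(x,u,u^{(r)};0)=0$, the differential of $\Delta(\cdot\,;0)$ with respect to the variables $u_{\alpha,J}$, $|J|\le r$, is onto $\mathbb R^q$. Write $f\approx 0$ for $f=O(\varepsilon^{p+1})$ as $\varepsilon\to0$. A generator is $\Xi=\sum_i\xi_i(x,u;\varepsilon)\,\partial_{x_i}+\sum_\alpha\eta_\alpha(x,u;\varepsilon)\,\partial_{u_\alpha}$ with $\xi_i,\eta_\alpha$ of class $C^\infty$ on $M\times E$; its $r$-th prolongation is $\Xi^{(r)}=\sum_i\xi_i\partial_{x_i}+\sum_{\alpha,\,|J|\le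 r}\eta_{\alpha,J}\,\partial_{u_{\alpha,J}}$, where $\eta_{\alpha,\emptyset}=\eta_\alpha$ and $\eta_{\alpha,J\cup\{i\}}=D_i\eta_{\alpha,J}-\sum_k (D_i\xi_k)\,u_{\alpha,J\cup\{k\}}$, $D_i$ being the total derivative with respect to $x_i$. The generator $\Xi$ is an approximate Lie point symmetry of the equation (at order $p$) if $\Xi^{(r)}\Delta\approx0$ on $\Delta\approx0$ after the expansion of the dependent variables is inserted, that is: for all $x$ and all $j_{(0)},\dots,j_{(p)}$ (values of $u_{\alpha,J}$, $|J|\le r$) with $(x,j_{(0)})\in\Omega$, $$\Delta\Big(x,\sum_{k=0}^p\varepsilon^kj_{(k)};\varepsilon\Big)=O(\varepsilon^{p+1})\ \Longrightarrow\ (\Xi^{(r)}\Delta)\Big(x,\sum_{k=0}^p\varepsilon^kj_{(k)};\varepsilon\Big)=O(\varepsilon^{p+1}).$$ Its approximate generator is $\sum_{k=0}^p\varepsilon^k\widetilde\Xi_{(k)}$, where the coefficients $\widetilde\xi_{(k)i},\widetilde\eta_{(k)\alpha}$ of $\widetilde\Xi_{(k)}$ are the coefficients of $\varepsilon^k$ in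 the Taylor expansions at $\varepsilon=0$ of $\xi_i$ and $\eta_\alpha$ evaluated at $\big(x,\sum_{l=0}^p\varepsilon^l u_{(l)};\varepsilon\big)$, as functions of $(x,u_{(0)},\dots,u_{(p)})$ with $(x,u_{(0)})\in M$. The approximate Lie bracket of two approximate generators is $$[\Xi_1,\Xi_2]\approx\sum_{k=0}^p\varepsilon^k\sum_{i=0}^k\big[\widetilde\Xi_{1(i)},\widetilde\Xi_{2(k-i)}\big],$$ the derivatives with respect to $u_\alpha$ acting on the coefficients as derivatives with respect to $u_{(0)\alpha}$. Then the approximate generators of the approximate Lie point symmetries of the equation form an approximate Lie algebra: they are a real vector space closed under the approximate Lie bracket, and on it this bracket is bilinear, alternating and satisfies the Jacobi identity. -/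

import Mathlib

open scoped ContDiff Topology

noncomputable section

namespace ApproxLie

/-- The space of the independent and dependent variables `(x, u)`. -/
abbrev Base (n m : ℕ) : Type := (Fin n → ℝ) × (Fin m → ℝ)

/-- Labels `{i₁, …, i_k}`, `k ≤ r`, of the partial derivatives `∂ᵏ/∂x_{i₁}⋯∂x_{i_k}` of order at
most `r`; they are unordered because partial derivatives commute. -/
abbrev DerivIndex (n r : ℕ) : Type := {J : Multiset (Fin n) // J.card ≤ r}

instance derivIndexFinite (n r : ℕ) : Finite (DerivIndex n r) :=
  Finite.of_injective
    (fun J : DerivIndex n r =>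
      (⟨⟨J.1.card, Nat.lt_succ_of_le J.2⟩, ⟨J.1, rfl⟩⟩ : Σ k : Fin (r + 1), Sym (Fin n) k))
    (by
      rintro ⟨J, hJ⟩ ⟨K, hK⟩ h
      have h2 := congrArg
        (fun s : (Σ k : Fin (r + 1), Sym (Fin n) k) => (s.2 : Multiset (Fin n))) h
      exact Subtype.ext h2)

instance derivIndexFintype (n r : ℕ) : Fintype (DerivIndex n r) := Fintype.ofFinite _

/-- The values of the dependent variables and of their derivatives up to order `r`. -/
abbrev JetFibre (n m r : ℕ) : Type := Fin m → DerivIndex n r → ℝ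

/-- The jet space of order `r`, with coordinates `x_i` and `u_{α,J}`, `|J| ≤ r`. -/
abbrev Jet (n m r : ℕ) : Type := (Fin n → ℝ) × JetFibre n m r

variable {n m r : ℕ}

/-- The point `(x, u)` below a jet. -/
def Jet.base (z : Jet n m r) : Base n m := (z.1, fun α => z.2 α ⟨0, Nat.zero_le r⟩)

/-- The coordinate `u_{α,J}` of a jet (by convention `0` if `|J| > r`). -/
def Jet.coord (z : Jet n m r) (α : Fin m) (J : Multiset (Fin n)) : ℝ :=
  if h : J.card ≤ r then z.2 α ⟨J, h⟩ else 0

/-- The total derivative `D/Dx_i = ∂/∂x_i + ∑_{α,J} u_{α,J∪{i}} ∂/∂u_{α,J}`.  On the jet space of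
order `r` it is meant for functions that depend on derivatives of order less than `r` only. -/
def totalDeriv (i : Fin n) (F : Jet n m r → ℝ) (z : Jet n m r) : ℝ :=
  fderiv ℝ F z (Pi.single i 1, fun α J => z.coord α (i ::ₘ J.1))

/-- The prolonged infinitesimals `η_{α,i₁…i_k}` of a vector field `V = (ξ, η)`:
`η_{α,J∪{i}} = D η_{α,J}/Dx_i - ∑_k (D ξ_k/Dx_i) u_{α,J∪{k}}`. -/
def prolongCoeff (V : Base n m → Base n m) (α : Fin m) : List (Fin n) → Jet n m r → ℝ
  | [] => fun z => (V z.base).2 α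
  | i :: l => fun z =>
      totalDeriv i (prolongCoeff V α l) z
        - ∑ k : Fin n, totalDeriv i (fun y : Jet n m r => (V y.base).1 k) z
            * z.coord α (k ::ₘ (l : Multiset (Fin n)))

/-- The `r`-th prolongation of a vector field on the space of `(x, u)`, as a vector field on the
jet space of order `r`. -/
def prolong (V : Base n m → Base n m) (z : Jet n m r) : Jet n m r :=
  ((V z.base).1, fun α J => prolongCoeff V α (J.1.sort (· ≤ ·)) z)

/-- A generator `Ξ = ∑ ξ_i(x,u;ε) ∂/∂x_i + ∑ η_α(x,u;ε) ∂/∂u_α`, given by `(ξ, η)`. -/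
abbrev Generator (n m : ℕ) : Type := Base n m → ℝ → Base n m

/-- `Ξ` is smooth for `(x, u) ∈ M` and `ε ∈ E`. -/
def Generator.IsSmooth (Ξ : Generator n m) (M : Set (Base n m)) (E : Set ℝ) : Prop :=
  ContDiffOn ℝ ∞ (Function.uncurry Ξ) (M ×ˢ E)

/-- A system of `q` differential equations `Δ(x, u, u^(r); ε) = 0`, given by its left-hand side. -/
abbrev DiffEq (n m r q : ℕ) : Type := Jet n m r → ℝ → (Fin q → ℝ)

/-- The function `Ξ^(r) Δ` on the jet space. -/
def prolongedAction {q : ℕ} (Ξ : Generator n m) (Δ : DiffEq n m r q) : DiffEq n m r q :=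
  fun z ε => fderiv ℝ (fun y => Δ y ε) z (prolong (fun w => Ξ w ε) z)

/-- `f ≈ 0` at order `p`, that is, `f(ε) = O(ε^{p+1})` as `ε → 0`. -/
def ApproxZero {V : Type*} [NormedAddCommGroup V] (p : ℕ) (f : ℝ → V) : Prop :=
  f =O[𝓝 0] fun ε : ℝ => ε ^ (p + 1)

/-- The expansion `v_(0) + ε v_(1) + ⋯ + ε^p v_(p)`. -/
def expansion {V : Type*} [AddCommGroup V] [Module ℝ V] {p : ℕ} (v : Fin (p + 1) → V) (ε : ℝ) : V :=
  ∑ k : Fin (p + 1), ε ^ (k : ℕ) • v k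

/-- The approximate invariance condition `Ξ^(r) Δ ≈ 0` on `Δ ≈ 0`, where the expansions at order `p`
of the dependent variables and of their derivatives are inserted; `Ω` is the domain of `Δ`. -/
def IsApproxSymmetry {q : ℕ} (p : ℕ) (Ω : Set (Jet n m r)) (Δ : DiffEq n m r q)
    (Ξ : Generator n m) : Prop :=
  ∀ (x : Fin n → ℝ) (j : Fin (p + 1) → JetFibre n m r), (x, j 0) ∈ Ω →
    ApproxZero p (fun ε => Δ (x, expansion j ε) ε) →
    ApproxZero p (fun ε => prolongedAction Ξ Δ (x, expansion j ε) ε)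

/-- The variables `(x, u_(0), …, u_(p))`. -/
abbrev ExpandedBase (n m p : ℕ) : Type := (Fin n → ℝ) × (Fin (p + 1) → Fin m → ℝ)

/-- An approximate generator `∑_k ε^k Ξ̃_(k)`, given by the coefficients
`(ξ̃_(k), η̃_(k))`, `k = 0, …, p`, as functions of `(x, u_(0), …, u_(p))`. -/
abbrev ApproxGenerator (n m p : ℕ) : Type := Fin (p + 1) → ExpandedBase n m p → Base n m

open Classical in
/-- The approximate generator of `Ξ`: `Ξ̃_(k)` is the coefficient of `ε^k` in the Taylor expansion
of `Ξ(x, u_(0) + ε u_(1) + ⋯ + ε^p u_(p); ε)`.  The coefficients live where `(x, u_(0)) ∈ M`, and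
are set to `0` elsewhere, so that two of them are equal when they agree on that domain. -/
def Generator.expand (p : ℕ) (M : Set (Base n m)) (Ξ : Generator n m) : ApproxGenerator n m p :=
  fun k w =>
    if (w.1, w.2 0) ∈ M then
      ((k : ℕ).factorial : ℝ)⁻¹ •
        iteratedDeriv k (fun ε : ℝ => Ξ (w.1, expansion w.2 ε) ε) 0
    else 0

/-- The action of `Ξ̃ = ∑ ξ̃_i ∂/∂x_i + ∑ η̃_α ∂/∂u_α` on a function of the expanded variables, the
derivatives with respect to `u_α` being those with respect to `u_(0)α`. -/
def dirDeriv {p : ℕ} (A : ExpandedBase n m p → Base n m) (B : ExpandedBase n m p → Base n m)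
    (w : ExpandedBase n m p) : Base n m :=
  fderiv ℝ B w ((A w).1, Pi.single 0 (A w).2)

/-- The approximate Lie bracket `[Ξ₁, Ξ₂] ≈ ∑_k ε^k ∑_{i+j=k} [Ξ̃₁_(i), Ξ̃₂_(j)]`. -/
def approxBracket {p : ℕ} (G H : ApproxGenerator n m p) : ApproxGenerator n m p :=
  fun k w => ∑ i : Fin (p + 1), ∑ j : Fin (p + 1),
    if (i : ℕ) + j = k then dirDeriv (G i) (H j) w - dirDeriv (H j) (G i) w else 0

/-- A set of approximate generators is an approximate Lie algebra: it is a real vector space, closed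
under the approximate Lie bracket, which is bilinear, alternating and satisfies the Jacobi
identity on it. -/
structure IsApproxLieAlgebra {p : ℕ} (S : Set (ApproxGenerator n m p)) : Prop where
  zero_mem : (0 : ApproxGenerator n m p) ∈ S
  add_mem : ∀ G ∈ S, ∀ H ∈ S, G + H ∈ S
  smul_mem : ∀ (c : ℝ), ∀ G ∈ S, c • G ∈ S
  bracket_mem : ∀ G ∈ S, ∀ H ∈ S, approxBracket G H ∈ S
  add_bracket : ∀ G ∈ S, ∀ H ∈ S, ∀ K ∈ S,
    approxBracket (G + H) K = approxBracket G K + approxBracket H K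
  bracket_add : ∀ G ∈ S, ∀ H ∈ S, ∀ K ∈ S,
    approxBracket G (H + K) = approxBracket G H + approxBracket G K
  smul_bracket : ∀ (c : ℝ), ∀ G ∈ S, ∀ H ∈ S,
    approxBracket (c • G) H = c • approxBracket G H
  bracket_smul : ∀ (c : ℝ), ∀ G ∈ S, ∀ H ∈ S,
    approxBracket G (c • H) = c • approxBracket G H
  bracket_self : ∀ G ∈ S, approxBracket G G = 0
  jacobi : ∀ G ∈ S, ∀ H ∈ S, ∀ K ∈ S,
    approxBracket G (approxBracket H K) + approxBracket H (approxBracket K G)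
      + approxBracket K (approxBracket G H) = 0

/-- The approximate generators of the approximate Lie point symmetries of `Δ = 0`. -/
def approxSymmetries {q : ℕ} (p : ℕ) (M : Set (Base n m)) (E : Set ℝ) (Ω : Set (Jet n m r))
    (Δ : DiffEq n m r q) : Set (ApproxGenerator n m p) :=
  {G | ∃ Ξ : Generator n m, Ξ.IsSmooth M E ∧ IsApproxSymmetry p Ω Δ Ξ ∧ G = Ξ.expand p M}

/-- The unperturbed equation `Δ(x, u, u^(r); 0) = 0` has maximal rank with respect to the dependent
variables and their derivatives. -/
def HasMaximalRank {q : ℕ} (Ω : Set (Jet n m r)) (Δ : DiffEq n m r q) : Prop :=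
  ∀ z ∈ Ω, Δ z 0 = 0 →
    Function.Surjective fun v : JetFibre n m r => fderiv ℝ (fun y => Δ y 0) z (0, v)

end ApproxLie

end

/-! Inserting `u = ∑ ε^k u_(k)` and taking Taylor coefficients in `ε` turns the Lie bracket of
smooth generators into the approximate bracket (`approxBracket_expand`). Indeed `u_(0)` enters the
expansion with coefficient 1, so `∂/∂u_(0)` acts as `∂/∂u`, and the sum over `i + j = k` is the
Leibniz rule for Taylor coefficients. Bilinearity and the Jacobi identity are thus inherited from
honest vector fields, one `ε` at a time. What remains is that the bracket of two approximate
symmetries is again one.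

Prolongation respects brackets (`prolong_lieBracket`), so it suffices that `Ξ^(r)(H^(r) Δ) =
O(ε^{p+1})` on approximate solutions. For exact symmetries one writes `H^(r) Δ = λ Δ` and
differentiates. Here `F = H^(r) Δ` is only known to be small along curves with `x` fixed on which
`Δ` is small. Maximal rank in the fibre variables gives, by the inverse function theorem,
coordinates in which `F(w) = G(Δ(w), w)` and `G(0, (z, ε))` is the value of `F` along an exact
solution curve (`exists_fibre_solution`). Hence `G(0, (z, ε)) = O(ε^{p+1})` for every fixed `z`, and
by smoothness the `z`-derivative obeys the same bound locally uniformly (`fderiv_inl_isBigO`).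
Differentiating `F` along `Ξ^(r)` leaves three terms: one with the factor `Ξ^(r) Δ`, one bounded by
`Δ` through a Lipschitz estimate, and the derivative of `G(0, ·)`. All are `O(ε^{p+1})` on
approximate solutions (`fderiv_isBigO_of_isBigO_on_solutions`). -/

open scoped ContDiff Topology

noncomputable section

namespace ApproxLie

/-! ### Taylor coefficients and `O(ε^p)` estimates with parameters. -/

section Calculus

open Asymptotics Filter

variable {V W Z : Type*} [NormedAddCommGroup V] [NormedSpace ℝ V]
  [NormedAddCommGroup W] [NormedSpace ℝ W] [NormedAddCommGroup Z] [NormedSpace ℝ Z]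

/-- A function that vanishes for `ε = 0` and whose `ε`-derivative is `O(ε^p)`, locally uniformly in
the parameter, is `O(ε^{p+1})`, locally uniformly in the parameter. -/
theorem isBigO_pow_succ_of_fderiv_snd {p : ℕ} {h : V × ℝ → W} {v₀ : V}
    (hd : ∀ᶠ y in 𝓝 (v₀, (0 : ℝ)), DifferentiableAt ℝ h y)
    (h0 : ∀ᶠ v in 𝓝 v₀, h (v, 0) = 0)
    (hO : (fun y => fderiv ℝ h y (0, 1)) =O[𝓝 (v₀, (0 : ℝ))] fun y => y.2 ^ p) :
    h =O[𝓝 (v₀, (0 : ℝ))] fun y => y.2 ^ (p + 1) := by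
  obtain ⟨C, hC⟩ := hO.bound
  have h0' : ∀ᶠ y in 𝓝 (v₀, (0 : ℝ)), h (y.1, 0) = 0 :=
    (continuous_fst.tendsto (v₀, (0 : ℝ))).eventually h0
  obtain ⟨δ, hδ, hball⟩ := Metric.eventually_nhds_iff_ball.1 (hd.and (h0'.and hC))
  refine IsBigO.of_bound C ?_
  filter_upwards [Metric.ball_mem_nhds (v₀, (0 : ℝ)) hδ]
  rintro ⟨v, ε⟩ hy
  have hmem : ∀ t ∈ Set.uIcc 0 ε, (v, t) ∈ Metric.ball (v₀, (0 : ℝ)) δ ∧ |t| ≤ |ε| := by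
    intro t ht
    have hab : |t| ≤ |ε| := by
      simpa using Set.abs_sub_left_of_mem_uIcc ht
    refine ⟨?_, hab⟩
    rw [← ball_prod_same, Set.mem_prod] at hy ⊢
    refine ⟨hy.1, ?_⟩
    have := hy.2
    simp only [Metric.mem_ball, Real.dist_eq, sub_zero] at this ⊢
    exact hab.trans_lt this
  have hC0 : h (v, 0) = 0 := (hball (v, ε) hy).2.1
  have key := (convex_uIcc (0 : ℝ) ε).norm_image_sub_le_of_norm_hasDerivWithin_le
    (f := fun t => h (v, t)) (f' := fun t => fderiv ℝ h (v, t) (0, 1)) (C := C * |ε| ^ p)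
    (x := 0) (y := ε)
    (fun t ht => by
      have h1 := (hball _ (hmem t ht).1).1.hasFDerivAt
      have h2 : HasDerivAt (fun t : ℝ => (v, t)) ((0 : V), (1 : ℝ)) t :=
        (hasDerivAt_const t v).prodMk (hasDerivAt_id t)
      exact (h1.comp_hasDerivAt t h2).hasDerivWithinAt)
    (fun t ht => by
      have h1 := (hball _ (hmem t ht).1).2.2
      have h2 := (hmem t ht).2
      -- The constant extracted from the `O`-bound may be negative; monotonicity in `|t| ≤ |ε|`
      -- needs `0 ≤ C`, and otherwise the bound itself forces `t ^ p = 0`.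
      have hCC : 0 ≤ C ∨ t ^ p = 0 := by
        by_contra! hcon
        have : 0 < ‖t ^ p‖ := norm_pos_iff.2 hcon.2
        have := (norm_nonneg _).trans h1
        nlinarith [hcon.1]
      rcases hCC with hCC | hCC
      · refine h1.trans ?_
        simp only [norm_pow, Real.norm_eq_abs]
        gcongr
      · simp only [hCC, norm_zero, mul_zero] at h1
        refine h1.trans ?_
        have h3 := (hball _ hy).2.2
        have := (norm_nonneg _).trans h3
        simpa using this)
    Set.left_mem_uIcc Set.right_mem_uIcc
  simp only [hC0, sub_zero] at key
  refine key.trans (le_of_eq ?_)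
  simp [pow_succ, mul_assoc]

/-- The coefficient of `ε^k` in the Taylor expansion of `f` at `0`. -/
def taylorCoeff (k : ℕ) (f : ℝ → W) : W := ((k : ℕ).factorial : ℝ)⁻¹ • iteratedDeriv k f 0

theorem taylorCoeff_zero (f : ℝ → W) : taylorCoeff 0 f = f 0 := by simp [taylorCoeff]

theorem taylorCoeff_succ (k : ℕ) (f : ℝ → W) :
    ((k : ℝ) + 1) • taylorCoeff (k + 1) f = taylorCoeff k (deriv f) := by
  rw [taylorCoeff, taylorCoeff, iteratedDeriv_succ', smul_smul, Nat.factorial_succ]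
  congr 1
  have : ((k : ℝ) + 1) ≠ 0 := by positivity
  push_cast
  field_simp

theorem taylorCoeff_congr {f g : ℝ → W} (h : f =ᶠ[𝓝 0] g) (k : ℕ) :
    taylorCoeff k f = taylorCoeff k g := by
  rw [taylorCoeff, taylorCoeff, h.iteratedDeriv_eq]

theorem taylorCoeff_add {k : ℕ} {f g : ℝ → W} (hf : ContDiffAt ℝ k f 0) (hg : ContDiffAt ℝ k g 0) :
    taylorCoeff k (fun ε => f ε + g ε) = taylorCoeff k f + taylorCoeff k g := by
  rw [taylorCoeff, taylorCoeff, taylorCoeff, ← smul_add, ← iteratedDeriv_add hf hg]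
  rfl

theorem taylorCoeff_sub {k : ℕ} {f g : ℝ → W} (hf : ContDiffAt ℝ k f 0) (hg : ContDiffAt ℝ k g 0) :
    taylorCoeff k (fun ε => f ε - g ε) = taylorCoeff k f - taylorCoeff k g := by
  rw [taylorCoeff, taylorCoeff, taylorCoeff, ← smul_sub, ← iteratedDeriv_sub hf hg]
  rfl

theorem taylorCoeff_const_smul {k : ℕ} {f : ℝ → W} (hf : ContDiffAt ℝ k f 0) (c : ℝ) :
    taylorCoeff k (fun ε => c • f ε) = c • taylorCoeff k f := by
  rw [taylorCoeff, taylorCoeff, smul_comm c, ← iteratedDeriv_const_smul hf c]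
  rfl

theorem contDiffAt_deriv {k : ℕ} {f : ℝ → W} (hf : ContDiffAt ℝ (k + 1 : ℕ) f 0) :
    ContDiffAt ℝ k (deriv f) 0 := by
  have h1 : ContDiffAt ℝ k (fderiv ℝ f) 0 := hf.fderiv_right (by norm_cast)
  exact h1.clm_apply contDiffAt_const

theorem eventually_differentiableAt {k : ℕ} {f : V → W} {x : V} (hf : ContDiffAt ℝ (k + 1 : ℕ) f x) :
    ∀ᶠ y in 𝓝 x, DifferentiableAt ℝ f y := by
  filter_upwards [hf.eventually (by simp)] with y hy
  exact hy.differentiableAt (by simp)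

/-- The Taylor formula at `0`. -/
theorem sub_taylor_isBigO (p : ℕ) {g : ℝ → W} (hg : ContDiffAt ℝ p g 0) :
    (fun ε => g ε - ∑ k ∈ Finset.range p, ε ^ k • taylorCoeff k g) =O[𝓝 0] fun ε : ℝ => ε ^ p := by
  induction p generalizing g with
  | zero =>
    simp only [Finset.range_zero, Finset.sum_empty, sub_zero, pow_zero]
    exact hg.continuousAt.isBigO_one ℝ
  | succ p ih =>
    have h1 := ih (contDiffAt_deriv hg)
    set d : ℝ → W := fun ε => g ε - ∑ k ∈ Finset.range (p + 1), ε ^ k • taylorCoeff k g with hd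
    -- The derivative of the remainder of `g` is the remainder of `g'` one order lower, to which the
    -- induction hypothesis applies.
    have hderiv : ∀ ε, DifferentiableAt ℝ g ε → HasDerivAt d
        (deriv g ε - ∑ k ∈ Finset.range p, ε ^ k • taylorCoeff k (deriv g)) ε := by
      intro ε hε
      refine hε.hasDerivAt.sub ?_
      have : HasDerivAt (fun ε : ℝ => ∑ k ∈ Finset.range (p + 1), ε ^ k • taylorCoeff k g)
          (∑ k ∈ Finset.range (p + 1), (k * ε ^ (k - 1)) • taylorCoeff k g) ε :=
        HasDerivAt.fun_sum fun k _ => (hasDerivAt_pow k ε).smul_const _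
      convert this using 1
      rw [Finset.sum_range_succ']
      simp only [Nat.cast_zero, zero_mul, zero_smul, add_zero, ← taylorCoeff_succ, smul_smul]
      refine Finset.sum_congr rfl fun k _ => ?_
      congr 1
      push_cast
      simp [mul_comm]
    have hdiff := eventually_differentiableAt hg
    have htend : Tendsto (fun y : ℝ × ℝ => y.2) (𝓝 ((0 : ℝ), (0 : ℝ))) (𝓝 0) :=
      continuous_snd.tendsto' _ _ rfl
    have hfd : ∀ y : ℝ × ℝ, DifferentiableAt ℝ g y.2 →
        HasFDerivAt (fun y : ℝ × ℝ => d y.2) ((ContinuousLinearMap.toSpanSingleton ℝ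
          (deriv g y.2 - ∑ k ∈ Finset.range p, y.2 ^ k • taylorCoeff k (deriv g))).comp
          (ContinuousLinearMap.snd ℝ ℝ ℝ)) y := fun y hy =>
      (hderiv _ hy).hasFDerivAt.comp y hasFDerivAt_snd
    -- A dummy real parameter makes the parametrised integration lemma applicable.
    have key := isBigO_pow_succ_of_fderiv_snd (p := p) (h := fun y : ℝ × ℝ => d y.2) (v₀ := (0 : ℝ))
      ((htend.eventually hdiff).mono fun y hy => (hfd y hy).differentiableAt)
      (Eventually.of_forall fun v => by
        simp [hd, Finset.sum_range_succ', taylorCoeff_zero])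
      ((h1.comp_tendsto htend).congr' ((htend.eventually hdiff).mono fun y hy => by
        simp [(hfd y hy).fderiv]) EventuallyEq.rfl)
    have ht2 : Tendsto (fun ε : ℝ => ((0 : ℝ), ε)) (𝓝 0) (𝓝 ((0 : ℝ), (0 : ℝ))) :=
      (Continuous.prodMk_right (0 : ℝ)).tendsto' _ _ rfl
    exact key.comp_tendsto ht2

/-- Letting `ε → 0` kills the constant coefficient; then one divides by `ε` and inducts. The
division is the reason for the punctured neighbourhood. -/
theorem coeff_eq_zero_of_isBigO (p : ℕ) (c : ℕ → W)
    (h : (fun ε : ℝ => ∑ k ∈ Finset.range p, ε ^ k • c k) =O[𝓝[≠] 0] fun ε : ℝ => ε ^ p) :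
    ∀ k < p, c k = 0 := by
  induction p generalizing c with
  | zero => simp
  | succ p ih =>
    have h0 : c 0 = 0 := by
      have h1 : Tendsto (fun ε : ℝ => ∑ k ∈ Finset.range (p + 1), ε ^ k • c k) (𝓝[≠] 0) (𝓝 (c 0)) := by
        refine Tendsto.mono_left (Continuous.tendsto' (by fun_prop) _ _ ?_) nhdsWithin_le_nhds
        simp [Finset.sum_range_succ']
      have h2 : Tendsto (fun ε : ℝ => ε ^ (p + 1)) (𝓝[≠] 0) (𝓝 0) :=
        Tendsto.mono_left (Continuous.tendsto' (by fun_prop) _ _ (by simp)) nhdsWithin_le_nhds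
      exact tendsto_nhds_unique h1 (h.trans_tendsto h2)
    have h3 : (fun ε : ℝ => ∑ k ∈ Finset.range p, ε ^ k • c (k + 1)) =O[𝓝[≠] 0]
        fun ε : ℝ => ε ^ p := by
      have h4 := (isBigO_refl (fun ε : ℝ => ε⁻¹) (𝓝[≠] 0)).smul h
      refine h4.congr' ?_ ?_
      · filter_upwards [self_mem_nhdsWithin] with ε hε
        have hε : ε ≠ 0 := hε
        rw [Finset.sum_range_succ', h0, smul_zero, add_zero, Finset.smul_sum]
        refine Finset.sum_congr rfl fun k _ => ?_
        rw [smul_smul, pow_succ']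
        field_simp
      · filter_upwards [self_mem_nhdsWithin] with ε hε
        have hε : ε ≠ 0 := hε
        rw [smul_eq_mul, pow_succ']
        field_simp
    rintro (_ | k) hk
    · exact h0
    · exact ih (fun k => c (k + 1)) h3 k (by omega)

theorem apply_zero_of_isBigO {A : Type*} [NormedAddCommGroup A] {p : ℕ} {g : ℝ → A} (h : g =O[𝓝 0] fun ε : ℝ => ε ^ (p + 1)) :
    g 0 = 0 := by
  obtain ⟨C, hC⟩ := h.bound
  simpa using hC.self_of_nhds

/-- The Taylor coefficients of order less than `p` of a function that is `O(ε^p)` vanish. -/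
theorem taylorCoeff_eq_zero_of_isBigO {p : ℕ} {g : ℝ → W} (hg : ContDiffAt ℝ p g 0)
    (h : g =O[𝓝 0] fun ε : ℝ => ε ^ p) : ∀ k < p, taylorCoeff k g = 0 := by
  refine coeff_eq_zero_of_isBigO p _ (IsBigO.mono ?_ nhdsWithin_le_nhds)
  simpa using h.sub (sub_taylor_isBigO p hg)

/-- An `O`-bound cannot be differentiated in general. For smooth `g` it says that the low Taylor
coefficients vanish, and so do those of `g'`. -/
theorem deriv_isBigO_of_isBigO {p : ℕ} {g : ℝ → W} (hg : ContDiffAt ℝ (p + 1 : ℕ) g 0)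
    (h : g =O[𝓝 0] fun ε : ℝ => ε ^ (p + 1)) : deriv g =O[𝓝 0] fun ε : ℝ => ε ^ p := by
  have h1 := sub_taylor_isBigO p (contDiffAt_deriv hg)
  have h2 := taylorCoeff_eq_zero_of_isBigO hg h
  refine h1.congr_left fun ε => ?_
  rw [Finset.sum_eq_zero, sub_zero]
  intro k hk
  rw [← taylorCoeff_succ, h2 (k + 1) (by have := Finset.mem_range.1 hk; omega), smul_zero, smul_zero]

theorem hasDerivAt_prodMk_right {f : V × ℝ → W} {v : V} {ε : ℝ}
    (hf : DifferentiableAt ℝ f (v, ε)) :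
    HasDerivAt (fun t => f (v, t)) (fderiv ℝ f (v, ε) (0, 1)) ε := by
  have h2 : HasDerivAt (fun t : ℝ => (v, t)) ((0 : V), (1 : ℝ)) ε :=
    (hasDerivAt_const ε v).prodMk (hasDerivAt_id ε)
  exact hf.hasFDerivAt.comp_hasDerivAt ε h2

theorem contDiffAt_prodMk_right {n : ℕ∞ω} {f : V × ℝ → W} {v : V} {ε : ℝ}
    (hf : ContDiffAt ℝ n f (v, ε)) : ContDiffAt ℝ n (fun t => f (v, t)) ε :=
  ContDiffAt.comp ε (f := fun t : ℝ => (v, t)) hf (contDiffAt_const.prodMk contDiffAt_id)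

theorem eventually_contDiffAt_slice {k : ℕ} {f : V × ℝ → W} {v₀ : V}
    (hf : ContDiffAt ℝ k f (v₀, 0)) : ∀ᶠ v in 𝓝 v₀, ContDiffAt ℝ k f (v, 0) :=
  ((Continuous.prodMk_left (0 : ℝ)).tendsto' v₀ (v₀, (0 : ℝ)) rfl).eventually
    (hf.eventually (by simp))

/-- The order of `a` and `b` on the right hides the symmetry of the second derivative; it serves to
exchange `∂_ε` with derivatives in the parameter. -/
theorem fderiv_fderiv_apply {f : V → W} {x : V} (hf : ContDiffAt ℝ 2 f x) (a b : V) :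
    fderiv ℝ (fun y => fderiv ℝ f y a) x b = fderiv ℝ (fderiv ℝ f) x a b := by
  have h1 : DifferentiableAt ℝ (fderiv ℝ f) x :=
    (hf.fderiv_right (m := 1) (by norm_num)).differentiableAt (by simp)
  rw [fderiv_clm_apply h1 (differentiableAt_const a)]
  simp only [fderiv_fun_const, Pi.zero_apply, ContinuousLinearMap.comp_zero, zero_add]
  exact (hf.isSymmSndFDerivAt (by simp)).eq b a

/-- If `f(v, ε) = O(ε^p)` for every `v` near `v₀`, then the derivative of `f` with respect to `v` is
`O(ε^p)`, locally uniformly in `v`. -/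
theorem fderiv_inl_isBigO {p : ℕ} {f : V × ℝ → W} {v₀ : V} (hf : ContDiffAt ℝ (p + 1 : ℕ) f (v₀, 0))
    (h : ∀ᶠ v in 𝓝 v₀, (fun ε => f (v, ε)) =O[𝓝 0] fun ε : ℝ => ε ^ p) :
    (fun y => (fderiv ℝ f y).comp (ContinuousLinearMap.inl ℝ V ℝ)) =O[𝓝 (v₀, (0 : ℝ))]
      fun y => y.2 ^ p := by
  have hcd : ∀ {k : ℕ} {g : V × ℝ → W}, ContDiffAt ℝ (k + 1 : ℕ) g (v₀, 0) →
      ContDiffAt ℝ k (fun y => (fderiv ℝ g y).comp (ContinuousLinearMap.inl ℝ V ℝ)) (v₀, 0) :=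
    fun hg => (hg.fderiv_right (by norm_cast)).clm_comp contDiffAt_const
  induction p generalizing f with
  | zero =>
    simp only [pow_zero]
    exact (hcd hf).continuousAt.isBigO_one ℝ
  | succ p ih =>
    have hf' : ContDiffAt ℝ (p + 1 : ℕ) (fun y => fderiv ℝ f y (0, 1)) (v₀, 0) :=
      (hf.fderiv_right (by norm_cast)).clm_apply contDiffAt_const
    have hd := eventually_differentiableAt hf
    have h0 : ∀ᶠ v in 𝓝 v₀, f (v, 0) = 0 := by
      filter_upwards [h] with v hv
      exact apply_zero_of_isBigO hv
    -- The parameter derivative vanishes at `ε = 0` because `f(·, 0)` is zero near `v₀`; its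
    -- `ε`-derivative is the parameter derivative of `∂_ε f`, which the induction hypothesis bounds.
    refine isBigO_pow_succ_of_fderiv_snd (eventually_differentiableAt (hcd hf)) ?_ ?_
    · have hd0 : ∀ᶠ v in 𝓝 v₀, DifferentiableAt ℝ f (v, 0) :=
        ((Continuous.prodMk_left (0 : ℝ)).tendsto' v₀ (v₀, (0 : ℝ)) rfl).eventually hd
      filter_upwards [h0.eventually_nhds, hd0] with v hv hdv
      have h1 : HasFDerivAt (fun w => f (w, 0))
          ((fderiv ℝ f (v, 0)).comp (ContinuousLinearMap.inl ℝ V ℝ)) v :=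
        hdv.hasFDerivAt.comp v (hasFDerivAt_prodMk_left v 0)
      have h2 : HasFDerivAt (fun w => f (w, 0)) (0 : V →L[ℝ] W) v :=
        (hasFDerivAt_const (0 : W) v).congr_of_eventuallyEq hv
      exact h1.unique h2
    · have h3 := ih hf' (by
        filter_upwards [h, eventually_contDiffAt_slice hf] with v hv hcv
        refine (deriv_isBigO_of_isBigO ((contDiffAt_prodMk_right hcv).of_le
          (by norm_cast; omega)) hv).congr' ?_ EventuallyEq.rfl
        have := eventually_differentiableAt hcv
        filter_upwards [((Continuous.prodMk_right v).tendsto' (0 : ℝ) (v, (0 : ℝ)) rfl).eventually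
          this] with ε hε
        exact (hasDerivAt_prodMk_right hε).deriv)
      refine h3.congr' ?_ EventuallyEq.rfl
      filter_upwards [hf.eventually (by simp)] with y hy
      have hy2 : ContDiffAt ℝ 2 f y := hy.of_le (by norm_cast; omega)
      have h1 : DifferentiableAt ℝ (fderiv ℝ f) y :=
        (hy2.fderiv_right (m := 1) (by norm_num)).differentiableAt (by simp)
      ext a
      rw [fderiv_clm_comp h1 (differentiableAt_const _)]
      simp [fderiv_fderiv_apply hy2]

end Calculus

/-! ### Leibniz rule and parameter derivatives for Taylor coefficients. -/

section Calculus

open Asymptotics Filter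

variable {V W Z : Type*} [NormedAddCommGroup V] [NormedSpace ℝ V]
  [NormedAddCommGroup W] [NormedSpace ℝ W] [NormedAddCommGroup Z] [NormedSpace ℝ Z]

/-- The Leibniz rule for Taylor coefficients. -/
theorem taylorCoeff_bilinear {k : ℕ} (B : V →L[ℝ] W →L[ℝ] Z) {f : ℝ → V} {g : ℝ → W}
    (hf : ContDiffAt ℝ k f 0) (hg : ContDiffAt ℝ k g 0) :
    taylorCoeff k (fun ε => B (f ε) (g ε)) =
      ∑ ij ∈ Finset.HasAntidiagonal.antidiagonal k, B (taylorCoeff ij.1 f) (taylorCoeff ij.2 g) := by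
  induction k generalizing f g with
  | zero => simp [taylorCoeff_zero]
  | succ k ih =>
    have hk : ((k : ℝ) + 1) ≠ 0 := by positivity
    have hBcd : ∀ {f : ℝ → V} {g : ℝ → W}, ContDiffAt ℝ k f 0 → ContDiffAt ℝ k g 0 →
        ContDiffAt ℝ k (fun ε => B (f ε) (g ε)) 0 := fun h1 h2 =>
      (B.contDiff.contDiffAt.comp _ h1).clm_apply h2
    have hf1 : ContDiffAt ℝ k f 0 := hf.of_le (by norm_cast; omega)
    have hg1 : ContDiffAt ℝ k g 0 := hg.of_le (by norm_cast; omega)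
    have hderiv : deriv (fun ε => B (f ε) (g ε)) =ᶠ[𝓝 0]
        fun ε => B (deriv f ε) (g ε) + B (f ε) (deriv g ε) := by
      filter_upwards [eventually_differentiableAt hf, eventually_differentiableAt hg] with ε h1 h2
      have h3 : HasDerivAt (fun ε => B (f ε)) (B (deriv f ε)) ε :=
        B.hasFDerivAt.comp_hasDerivAt ε h1.hasDerivAt
      exact (h3.clm_apply h2.hasDerivAt).deriv
    have hmain : ((k : ℝ) + 1) • taylorCoeff (k + 1) (fun ε => B (f ε) (g ε)) =
        ((k : ℝ) + 1) • ∑ ij ∈ Finset.HasAntidiagonal.antidiagonal (k + 1),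
          B (taylorCoeff ij.1 f) (taylorCoeff ij.2 g) := by
      rw [taylorCoeff_succ, taylorCoeff_congr hderiv,
        taylorCoeff_add (hBcd (contDiffAt_deriv hf) hg1) (hBcd hf1 (contDiffAt_deriv hg)),
        ih (contDiffAt_deriv hf) hg1, ih hf1 (contDiffAt_deriv hg)]
      simp only [← taylorCoeff_succ, map_smul, smul_apply]
      -- Write the weight as `k + 1 = i + j`. The terms with weight `i = 0`, respectively `j = 0`,
      -- drop out, and shifting the index gives the two sums of the product rule.
      have hsplit : ((k : ℝ) + 1) • ∑ ij ∈ Finset.HasAntidiagonal.antidiagonal (k + 1),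
            B (taylorCoeff ij.1 f) (taylorCoeff ij.2 g)
          = ∑ ij ∈ Finset.HasAntidiagonal.antidiagonal (k + 1),
              (ij.1 : ℝ) • B (taylorCoeff ij.1 f) (taylorCoeff ij.2 g)
            + ∑ ij ∈ Finset.HasAntidiagonal.antidiagonal (k + 1),
              (ij.2 : ℝ) • B (taylorCoeff ij.1 f) (taylorCoeff ij.2 g) := by
        rw [Finset.smul_sum, ← Finset.sum_add_distrib]
        refine Finset.sum_congr rfl fun ij hij => ?_
        rw [← add_smul]
        congr 1
        have := Finset.HasAntidiagonal.mem_antidiagonal.1 hij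
        exact_mod_cast this.symm
      rw [hsplit, Finset.Nat.sum_antidiagonal_succ, Finset.Nat.sum_antidiagonal_succ']
      simp
    exact smul_right_injective _ hk hmain

/-- Taylor coefficients in `ε` commute with derivatives with respect to parameters. -/
theorem hasFDerivAt_taylorCoeff {k : ℕ} {f : V × ℝ → W} {v : V}
    (hf : ContDiffAt ℝ (k + 1 : ℕ) f (v, 0)) :
    HasFDerivAt (fun w => taylorCoeff k (fun ε => f (w, ε)))
      (taylorCoeff k fun ε => (fderiv ℝ f (v, ε)).comp (ContinuousLinearMap.inl ℝ V ℝ)) v := by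
  induction k generalizing f with
  | zero =>
    simp only [taylorCoeff_zero]
    exact (hf.differentiableAt (by simp)).hasFDerivAt.comp v (hasFDerivAt_prodMk_left v 0)
  | succ k ih =>
    have hk : ((k : ℝ) + 1) ≠ 0 := by positivity
    have hf' : ContDiffAt ℝ (k + 1 : ℕ) (fun y => fderiv ℝ f y (0, 1)) (v, 0) :=
      (hf.fderiv_right (by norm_cast)).clm_apply contDiffAt_const
    -- The coefficient of order `k + 1` of `f` is that of order `k` of `∂_ε f`, divided by `k + 1`.
    have h1 := (ih hf').const_smul ((k : ℝ) + 1)⁻¹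
    have hslice : ∀ {w : V}, ContDiffAt ℝ (k + 1 + 1 : ℕ) f (w, 0) →
        ∀ᶠ ε in 𝓝 (0 : ℝ), ContDiffAt ℝ (k + 1 + 1 : ℕ) f (w, ε) := fun {w} hw =>
      ((Continuous.prodMk_right w).tendsto' (0 : ℝ) (w, (0 : ℝ)) rfl).eventually
        (hw.eventually (by simp))
    refine (h1.congr_of_eventuallyEq ?_).congr_fderiv ?_
    · filter_upwards [eventually_contDiffAt_slice hf] with w hw
      rw [Pi.smul_apply, eq_inv_smul_iff₀ hk, taylorCoeff_succ]
      refine taylorCoeff_congr ?_ k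
      filter_upwards [hslice hw] with ε hε
      exact (hasDerivAt_prodMk_right (hε.differentiableAt (by simp))).deriv
    · rw [inv_smul_eq_iff₀ hk, taylorCoeff_succ]
      refine taylorCoeff_congr ?_ k
      filter_upwards [hslice hf] with ε hε
      have hy2 : ContDiffAt ℝ 2 f (v, ε) := hε.of_le (by norm_cast; omega)
      have h1 : DifferentiableAt ℝ (fderiv ℝ f) (v, ε) :=
        (hy2.fderiv_right (m := 1) (by norm_num)).differentiableAt (by simp)
      have h2 := (hasDerivAt_prodMk_right
        (f := fun y => (fderiv ℝ f y).comp (ContinuousLinearMap.inl ℝ V ℝ))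
        (h1.clm_comp (differentiableAt_const _))).deriv
      rw [h2]
      ext a
      rw [fderiv_clm_comp h1 (differentiableAt_const _)]
      simp [fderiv_fderiv_apply hy2]

/-- A `C¹` map is Lipschitz near `x`. -/
theorem isBigO_comp_sub_comp {p : ℕ} {G : V → W} {x : V} (hG : ContDiffAt ℝ 1 G x)
    {a b : ℝ → V} (ha : Tendsto a (𝓝 0) (𝓝 x)) (hb : Tendsto b (𝓝 0) (𝓝 x))
    (hab : (fun ε => a ε - b ε) =O[𝓝 0] fun ε : ℝ => ε ^ p) :
    (fun ε => G (a ε) - G (b ε)) =O[𝓝 0] fun ε : ℝ => ε ^ p := by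
  obtain ⟨K, t, ht, hK⟩ := hG.exists_lipschitzOnWith
  refine IsBigO.trans (IsBigO.of_bound K ?_) hab
  filter_upwards [ha ht, hb ht] with ε h1 h2
  simpa [dist_eq_norm] using hK.dist_le_mul _ h1 _ h2

theorem isBigO_clm_apply {T : ℝ → V →L[ℝ] W} {u : ℝ → V} {f g : ℝ → ℝ} (hT : T =O[𝓝 0] f)
    (hu : u =O[𝓝 0] g) : (fun ε => T ε (u ε)) =O[𝓝 0] fun ε => f ε * g ε := by
  refine IsBigO.trans (IsBigO.of_bound 1 (Eventually.of_forall fun ε => ?_))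
    (hT.norm_left.mul hu.norm_left)
  simpa using (T ε).le_opNorm (u ε)

end Calculus

/-! ### Straightening the equation by the inverse function theorem. -/

section Straightening

open Asymptotics Filter

variable {X Y Q P : Type*} [NormedAddCommGroup X] [NormedSpace ℝ X] [CompleteSpace X]
  [NormedAddCommGroup Y] [NormedSpace ℝ Y] [CompleteSpace Y]
  [NormedAddCommGroup Q] [NormedSpace ℝ Q] [FiniteDimensional ℝ Q]
  [NormedAddCommGroup P] [NormedSpace ℝ P]

/-- The shear `(s, w) ↦ (s + A w, w)`. -/
def shear {A B : Type*} [NormedAddCommGroup A] [NormedSpace ℝ A] [NormedAddCommGroup B]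
    [NormedSpace ℝ B] (T : B →L[ℝ] A) : (A × B) ≃L[ℝ] (A × B) :=
  ContinuousLinearEquiv.equivOfInverse
    ((ContinuousLinearMap.fst ℝ A B + T.comp (ContinuousLinearMap.snd ℝ A B)).prod
      (ContinuousLinearMap.snd ℝ A B))
    ((ContinuousLinearMap.fst ℝ A B - T.comp (ContinuousLinearMap.snd ℝ A B)).prod
      (ContinuousLinearMap.snd ℝ A B))
    (fun x => by simp) (fun x => by simp)

/-- If the derivative of `D` along the fibre `Y` is onto, the equation `D((x, y + R s), ε) = c` has
near `(x₀, y₀, 0)` a unique small solution `s`, and this depends smoothly on `c, x, y, ε`. -/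
theorem exists_fibre_solution {N : ℕ} {D : (X × Y) × ℝ → Q} {z₀ : X × Y}
    (hD : ContDiffAt ℝ (N + 1 : ℕ) D (z₀, 0)) (hD0 : D (z₀, 0) = 0)
    (hsurj : Function.Surjective fun v : Y => fderiv ℝ D (z₀, 0) ((0, v), 0)) :
    ∃ (R : Q →L[ℝ] Y) (s : Q × ((X × Y) × ℝ) → Q),
      ContDiffAt ℝ (N + 1 : ℕ) s (0, (z₀, 0)) ∧ s (0, (z₀, 0)) = 0 ∧
      (∀ᶠ c in 𝓝 ((0 : Q), (z₀, (0 : ℝ))), D (c.2.1 + (0, R (s c)), c.2.2) = c.1) ∧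
      ∀ᶠ w in 𝓝 (z₀, (0 : ℝ)), s (D w, w) = 0 := by
  set D' := fderiv ℝ D (z₀, 0) with hD'
  obtain ⟨R, hR⟩ := ((D'.comp (ContinuousLinearMap.inl ℝ (X × Y) ℝ)).comp
    (ContinuousLinearMap.inr ℝ X Y)).exists_rightInverse_of_surjective
      (LinearMap.range_eq_top.2 hsurj)
  have hR' : ∀ s, D' ((0, R s), 0) = s := fun s => by
    simpa using congrArg (fun T => T s) hR
  let shift : Q × ((X × Y) × ℝ) →L[ℝ] (X × Y) × ℝ :=
    ((ContinuousLinearMap.inl ℝ (X × Y) ℝ).comp ((ContinuousLinearMap.inr ℝ X Y).comp R)).comp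
      (ContinuousLinearMap.fst ℝ _ _) + ContinuousLinearMap.snd ℝ _ _
  have hshift : ∀ c, shift c = (c.2.1 + (0, R c.1), c.2.2) := fun c => by
    simp [shift, Prod.ext_iff, add_comm]
  -- Since `D' ∘ R = id` on the fibre, the derivative of this map at the base point is the shear by
  -- `D'`, hence invertible. Its local inverse solves the equation for `s`.
  let Ψ : Q × ((X × Y) × ℝ) → Q × ((X × Y) × ℝ) := fun c => (D (shift c), c.2)
  have hs0 : shift (0, (z₀, 0)) = (z₀, 0) := by simp [hshift]
  have hDs : ContDiffAt ℝ (N + 1 : ℕ) D (shift (0, (z₀, 0))) := by rwa [hs0]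
  have hΨ : ContDiffAt ℝ (N + 1 : ℕ) Ψ (0, (z₀, 0)) :=
    (hDs.comp _ shift.contDiff.contDiffAt).prodMk contDiffAt_snd
  have hΨ' : HasFDerivAt Ψ ((shear D' : (Q × ((X × Y) × ℝ)) ≃L[ℝ] _) :
      Q × ((X × Y) × ℝ) →L[ℝ] Q × ((X × Y) × ℝ)) (0, (z₀, 0)) := by
    have h1 : HasFDerivAt D D' (shift (0, (z₀, 0))) := by
      rw [hs0]
      exact (hD.differentiableAt (by simp)).hasFDerivAt
    refine ((h1.comp _ shift.hasFDerivAt).prodMk hasFDerivAt_snd).congr_fderiv ?_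
    refine ContinuousLinearMap.ext fun c => ?_
    have h2 : shift c = ((0, R c.1), 0) + c.2 := by
      rw [hshift]; simp [Prod.ext_iff, add_comm]
    have h3 : shear D' c = (c.1 + D' c.2, c.2) := rfl
    simp [h2, h3, hR']
  have hn : ((N + 1 : ℕ) : ℕ∞ω) ≠ 0 := by simp
  set e := hΨ.toOpenPartialHomeomorph Ψ hΨ' hn with he
  have hΨ0 : Ψ (0, (z₀, 0)) = (0, (z₀, 0)) := by simp [Ψ, hs0, hD0]
  have hsrc := hΨ.mem_toOpenPartialHomeomorph_source hΨ' hn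
  have htgt := hΨ.image_mem_toOpenPartialHomeomorph_target hΨ' hn
  have hloc : ContDiffAt ℝ (N + 1 : ℕ) e.symm (0, (z₀, 0)) := by
    have := hΨ.to_localInverse hΨ' hn
    rwa [hΨ0] at this
  rw [hΨ0] at htgt
  refine ⟨R, fun c => (e.symm c).1, hloc.fst, ?_, ?_, ?_⟩
  · have := hΨ.localInverse_apply_image hΨ' hn
    rw [hΨ0] at this
    exact congrArg Prod.fst this
  · filter_upwards [e.open_target.mem_nhds htgt] with c hc
    have h1 : Ψ (e.symm c) = c := e.right_inv hc
    have h2 : (e.symm c).2 = c.2 := congrArg (fun d => d.2) h1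
    have h3 : D (shift (e.symm c)) = c.1 := congrArg Prod.fst h1
    rw [hshift, h2] at h3
    exact h3
  -- `Ψ` sends `(0, w)` to `(D w, w)`, so the local inverse returns `s = 0` there.
  · have hcont : Tendsto (fun w : (X × Y) × ℝ => ((0 : Q), w)) (𝓝 (z₀, 0)) (𝓝 (0, (z₀, 0))) :=
      (Continuous.prodMk_right (0 : Q)).tendsto' _ _ rfl
    filter_upwards [hcont (e.open_source.mem_nhds hsrc)] with w hw
    have h1 : e.symm (Ψ (0, w)) = (0, w) := e.left_inv hw
    have h2 : Ψ (0, w) = (D w, w) := by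
      simp only [Ψ, hshift, map_zero, Prod.mk_zero_zero, add_zero]
    rw [h2] at h1
    exact congrArg Prod.fst h1

/-- If `F = O(ε^p)` along all curves in the fibres on which `D = O(ε^p)`, then the derivative of `F`
in a direction in which the derivative of `D` is `O(ε^p)` is `O(ε^p)` along every curve on which
`D = O(ε^p)`. -/
theorem fderiv_isBigO_of_isBigO_on_solutions {p : ℕ} {D : (X × Y) × ℝ → Q} {F : (X × Y) × ℝ → P}
    {z₀ : X × Y} (hD : ContDiffAt ℝ (p + 2 : ℕ) D (z₀, 0)) (hF : ContDiffAt ℝ (p + 2 : ℕ) F (z₀, 0))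
    (hD0 : D (z₀, 0) = 0)
    (hsurj : Function.Surjective fun v : Y => fderiv ℝ D (z₀, 0) ((0, v), 0))
    (hinv : ∀ᶠ z in 𝓝 z₀, ∀ y : ℝ → Y, ContDiffAt ℝ p y 0 → y 0 = z.2 →
      (fun ε => D ((z.1, y ε), ε)) =O[𝓝 0] (fun ε : ℝ => ε ^ p) →
      (fun ε => F ((z.1, y ε), ε)) =O[𝓝 0] (fun ε : ℝ => ε ^ p))
    {ζ v : ℝ → X × Y} (hζ : Tendsto ζ (𝓝 0) (𝓝 z₀))
    (hDζ : (fun ε => D (ζ ε, ε)) =O[𝓝 0] (fun ε : ℝ => ε ^ p))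
    (hv : v =O[𝓝 0] fun _ => (1 : ℝ))
    (hDv : (fun ε => fderiv ℝ D (ζ ε, ε) (v ε, 0)) =O[𝓝 0] (fun ε : ℝ => ε ^ p)) :
    (fun ε => fderiv ℝ F (ζ ε, ε) (v ε, 0)) =O[𝓝 0] (fun ε : ℝ => ε ^ p) := by
  obtain ⟨R, s, hs, hs0, hsol, huniq⟩ := exists_fibre_solution (N := p + 1) hD hD0 hsurj
  let τ : Q × ((X × Y) × ℝ) → (X × Y) × ℝ := fun c => (c.2.1 + (0, R (s c)), c.2.2)
  have hτ : ContDiffAt ℝ (p + 2 : ℕ) τ (0, (z₀, 0)) :=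
    (contDiffAt_snd.fst.add (contDiffAt_const.prodMk (R.contDiff.contDiffAt.comp _ hs))).prodMk
      contDiffAt_snd.snd
  have hτ0 : τ (0, (z₀, 0)) = (z₀, 0) := by simp [τ, hs0]
  let G : Q × ((X × Y) × ℝ) → P := fun c => F (τ c)
  have hG : ContDiffAt ℝ (p + 2 : ℕ) G (0, (z₀, 0)) := by
    have : ContDiffAt ℝ (p + 2 : ℕ) F (τ (0, (z₀, 0))) := by rwa [hτ0]
    exact this.comp _ hτ
  have hcont : Tendsto (fun w : (X × Y) × ℝ => ((0 : Q), w)) (𝓝 (z₀, 0)) (𝓝 (0, (z₀, 0))) :=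
    (Continuous.prodMk_right (0 : Q)).tendsto' _ _ rfl
  have hins : Tendsto (fun z : X × Y => (z, (0 : ℝ))) (𝓝 z₀) (𝓝 (z₀, 0)) :=
    (Continuous.prodMk_left (0 : ℝ)).tendsto' _ _ rfl
  have hg : ContDiffAt ℝ (p + 2 : ℕ) (fun w => G (0, w)) (z₀, 0) :=
    ContDiffAt.comp (z₀, 0) (f := fun w : (X × Y) × ℝ => ((0 : Q), w)) hG
      (contDiffAt_const.prodMk contDiffAt_id)
  -- For fixed `z`, the solution with `c = 0` traces a curve in the fibre on which `D` vanishes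
  -- exactly, so `hinv` applies. The curve starts at the point of `D(·, 0) = 0` over `z`, not at `z`
  -- itself; `hnear` keeps that point near `z₀`.
  have hgO : ∀ᶠ z in 𝓝 z₀, (fun ε => G (0, (z, ε))) =O[𝓝 0] fun ε : ℝ => ε ^ p := by
    have hs1 : ContDiffAt ℝ (p + 2 : ℕ) (fun w => s (0, w)) (z₀, 0) :=
      ContDiffAt.comp (z₀, 0) (f := fun w : (X × Y) × ℝ => ((0 : Q), w)) hs
        (contDiffAt_const.prodMk contDiffAt_id)
    have hnear : Tendsto (fun z : X × Y => z + (0, R (s (0, (z, 0))))) (𝓝 z₀) (𝓝 z₀) := by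
      have h1 : ContinuousAt (fun z : X × Y => z + (0, R (s (0, (z, 0))))) z₀ := by
        have h2 : ContinuousAt (fun z : X × Y => s (0, (z, 0))) z₀ :=
          ContinuousAt.comp (f := fun z : X × Y => (z, (0 : ℝ))) hs1.continuousAt
            (Continuous.prodMk_left (0 : ℝ)).continuousAt
        exact continuousAt_id.add (continuousAt_const.prodMk (R.continuous.continuousAt.comp h2))
      have := h1.tendsto
      simpa only [ContinuousAt, hs0, map_zero, Prod.mk_zero_zero, add_zero] using this
    filter_upwards [hnear.eventually hinv, eventually_contDiffAt_slice hs1,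
      hins.eventually (hcont.eventually hsol).eventually_nhds] with z hz hsz hsolz
    have hsolz' : ∀ᶠ ε in 𝓝 (0 : ℝ), D (z + (0, R (s (0, (z, ε)))), ε) = 0 :=
      ((Continuous.prodMk_right z).tendsto' (0 : ℝ) (z, (0 : ℝ)) rfl).eventually hsolz
    have hfst : ∀ ε, z + (0, R (s (0, (z, ε)))) = (z.1, z.2 + R (s (0, (z, ε)))) := fun ε => by
      simp [Prod.ext_iff]
    have h1 := hz (fun ε => z.2 + R (s (0, (z, ε))))
      (contDiffAt_const.add (R.contDiff.contDiffAt.comp _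
        ((contDiffAt_prodMk_right hsz).of_le (by norm_cast; omega)))) (by simp)
    simp only [Prod.fst_add, add_zero, ← hfst] at h1
    refine h1 ((isBigO_zero _ _).congr' ?_ EventuallyEq.rfl)
    filter_upwards [hsolz'] with ε hε
    exact hε.symm
  have hflat := fderiv_inl_isBigO (p := p) (hg.of_le (by norm_cast; omega)) hgO
  have hζ' : Tendsto (fun ε => (ζ ε, ε)) (𝓝 0) (𝓝 (z₀, 0)) := hζ.prodMk_nhds tendsto_id
  have hflat' : (fun ε => (fderiv ℝ (fun w => G (0, w)) (ζ ε, ε)).comp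
      (ContinuousLinearMap.inl ℝ (X × Y) ℝ)) =O[𝓝 0] fun ε : ℝ => ε ^ p :=
    hflat.comp_tendsto hζ'
  have hFG : F =ᶠ[𝓝 (z₀, 0)] fun w => G (D w, w) := by
    filter_upwards [huniq] with w hw
    simp only [G, τ, hw, map_zero, Prod.mk_zero_zero, add_zero]
  have hDw : Tendsto (fun w => (D w, w)) (𝓝 (z₀, (0 : ℝ))) (𝓝 (0, (z₀, 0))) := by
    have := hD.continuousAt.prodMk (continuousAt_id (x := (z₀, (0 : ℝ))))
    simpa [ContinuousAt, hD0] using this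
  -- Chain rule for `F(w) = G(D w, w)`, comparing the derivative of `G` at `(D w, w)` with that at
  -- `(0, w)`. The three terms are controlled by `hDv`, by `hDζ` with a Lipschitz bound, and by
  -- `hflat'`.
  have hchain : ∀ᶠ w in 𝓝 (z₀, (0 : ℝ)), ∀ a : X × Y, fderiv ℝ F w (a, 0) =
      fderiv ℝ G (D w, w) (fderiv ℝ D w (a, 0), 0)
        + ((fderiv ℝ G (D w, w) - fderiv ℝ G (0, w)) (0, (a, 0))
          + fderiv ℝ (fun w => G (0, w)) w (a, 0)) := by
    have hGd := eventually_differentiableAt (k := p + 1) hG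
    filter_upwards [Filter.EventuallyEq.eventuallyEq_nhds hFG, eventually_differentiableAt (k := p + 1) hD,
      hDw.eventually hGd, hcont.eventually hGd] with w h1 h2 h3 h4 a
    have h5 : HasFDerivAt (fun w => G (D w, w))
        ((fderiv ℝ G (D w, w)).comp ((fderiv ℝ D w).prod (ContinuousLinearMap.id ℝ _))) w :=
      HasFDerivAt.comp w (f := fun w => (D w, w)) h3.hasFDerivAt
        (h2.hasFDerivAt.prodMk (hasFDerivAt_id w))
    have h6 : HasFDerivAt (fun w => G (0, w))
        ((fderiv ℝ G (0, w)).comp (ContinuousLinearMap.inr ℝ _ _)) w :=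
      h4.hasFDerivAt.comp w (hasFDerivAt_prodMk_right 0 w)
    rw [h1.fderiv_eq, h5.fderiv, h6.fderiv]
    have h7 : ((fderiv ℝ D w (a, 0), (a, 0)) : Q × ((X × Y) × ℝ))
        = (fderiv ℝ D w (a, 0), 0) + (0, (a, 0)) := by simp
    simp only [ContinuousLinearMap.comp_apply, ContinuousLinearMap.prod_apply,
      ContinuousLinearMap.id_apply, ContinuousLinearMap.inr_apply, sub_apply]
    rw [h7, map_add]
    abel
  have hG' : ContDiffAt ℝ 1 (fderiv ℝ G) (0, (z₀, 0)) :=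
    (hG.of_le (m := 2) (by norm_cast; omega)).fderiv_right (by norm_num)
  have hlip : (fun ε => fderiv ℝ G (D (ζ ε, ε), (ζ ε, ε)) - fderiv ℝ G (0, (ζ ε, ε))) =O[𝓝 0]
      fun ε : ℝ => ε ^ p := by
    refine isBigO_comp_sub_comp hG' (hDw.comp hζ') (hcont.comp hζ') ?_
    refine IsBigO.of_norm_left (hDζ.norm_left.congr_left fun ε => ?_)
    simp [Prod.norm_def]
  have hbd : (fun ε => fderiv ℝ G (D (ζ ε, ε), (ζ ε, ε))) =O[𝓝 0] fun _ => (1 : ℝ) :=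
    (hG'.continuousAt.tendsto.comp (hDw.comp hζ')).isBigO_one ℝ
  have h1 := isBigO_clm_apply hbd
    ((ContinuousLinearMap.inl ℝ Q ((X × Y) × ℝ)).isBigO_comp _ _ |>.trans hDv)
  have hv' : (fun ε => ((0 : Q), ((v ε, 0) : (X × Y) × ℝ))) =O[𝓝 0] fun _ => (1 : ℝ) :=
    ((ContinuousLinearMap.inr ℝ Q ((X × Y) × ℝ)).comp
      (ContinuousLinearMap.inl ℝ (X × Y) ℝ)).isBigO_comp _ _ |>.trans hv
  have h2 := isBigO_clm_apply hlip hv'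
  have h3 := isBigO_clm_apply hflat' hv
  simp only [one_mul, mul_one] at h1 h2 h3
  refine (h1.add (h2.add h3)).congr' ?_ EventuallyEq.rfl
  filter_upwards [hζ'.eventually hchain] with ε hε
  rw [hε]
  rfl

end Straightening

/-! ### Total derivatives, prolongation and Lie brackets on the jet space. -/

section Jets

open Filter VectorField

variable {n m r : ℕ}

theorem minSmoothness_two_le : minSmoothness ℝ 2 ≤ (∞ : ℕ∞ω) := by
  rw [minSmoothness_of_isRCLikeNormedField]
  exact WithTop.coe_le_coe.2 (le_top : (2 : ℕ∞) ≤ ⊤)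

/-- The coordinate `u_{α,J}` as a continuous linear function on the jet space. -/
def coordCLM (α : Fin m) (J : Multiset (Fin n)) : Jet n m r →L[ℝ] ℝ :=
  if h : J.card ≤ r then
    ((ContinuousLinearMap.proj (⟨J, h⟩ : DerivIndex n r)).comp (ContinuousLinearMap.proj α)).comp
      (ContinuousLinearMap.snd ℝ (Fin n → ℝ) (JetFibre n m r))
  else 0

theorem coordCLM_apply (α : Fin m) (J : Multiset (Fin n)) (z : Jet n m r) :
    coordCLM α J z = z.coord α J := by
  unfold coordCLM Jet.coord
  split_ifs <;> rfl

/-- The projection of the jet space to the space of `(x, u)`, as a continuous linear map. -/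
def baseCLM : Jet n m r →L[ℝ] Base n m :=
  (ContinuousLinearMap.fst ℝ _ _).prod (ContinuousLinearMap.pi fun α =>
    ((ContinuousLinearMap.proj (⟨0, Nat.zero_le r⟩ : DerivIndex n r)).comp
      (ContinuousLinearMap.proj α)).comp (ContinuousLinearMap.snd ℝ (Fin n → ℝ) (JetFibre n m r)))

theorem baseCLM_apply (z : Jet n m r) : baseCLM z = z.base := rfl

theorem isOpen_base_preimage {M : Set (Base n m)} (hM : IsOpen M) :
    IsOpen {z : Jet n m r | z.base ∈ M} :=
  hM.preimage (baseCLM (n := n) (m := m) (r := r)).continuous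

/-- The vector field on the jet space whose action on functions is the total derivative. -/
def totalField (i : Fin n) (z : Jet n m r) : Jet n m r :=
  (Pi.single i 1, fun α J => z.coord α (i ::ₘ J.1))

/-- The linear part of `totalField`. -/
def totalLin (i : Fin n) : Jet n m r →L[ℝ] Jet n m r :=
  ContinuousLinearMap.prod 0
    (ContinuousLinearMap.pi fun α => ContinuousLinearMap.pi fun J => coordCLM α (i ::ₘ J.1))

theorem totalLin_apply (i : Fin n) (z : Jet n m r) :
    totalLin i z = (0, fun α J => z.coord α (i ::ₘ J.1)) := by
  simp only [totalLin, ContinuousLinearMap.prod_apply, Prod.mk.injEq]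
  refine ⟨rfl, ?_⟩
  ext α J
  exact coordCLM_apply α _ z

theorem totalField_eq (i : Fin n) (z : Jet n m r) :
    totalField i z = (Pi.single i 1, 0) + totalLin i z := by
  simp [totalField, totalLin_apply]

theorem hasFDerivAt_totalField (i : Fin n) (z : Jet n m r) :
    HasFDerivAt (totalField i) (totalLin i) z := by
  have h : (totalField i : Jet n m r → Jet n m r) = fun z => (Pi.single i 1, 0) + totalLin i z :=
    funext (totalField_eq i)
  rw [h]
  exact (totalLin i).hasFDerivAt.const_add _

theorem contDiff_totalField (i : Fin n) {k : ℕ∞ω} :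
    ContDiff ℝ k (totalField i : Jet n m r → Jet n m r) := by
  have h : (totalField i : Jet n m r → Jet n m r) = fun z => (Pi.single i 1, 0) + totalLin i z :=
    funext (totalField_eq i)
  rw [h]
  exact contDiff_const.add (totalLin i).contDiff

theorem totalDeriv_eq (i : Fin n) (F : Jet n m r → ℝ) (z : Jet n m r) :
    totalDeriv i F z = fderiv ℝ F z (totalField i z) := rfl

/-- The convention that coordinates of order above `r` are zero makes this hold for every `J`; hence
the truncated total derivatives commute without restriction on the order. -/
theorem coord_totalField (i : Fin n) (z : Jet n m r) (α : Fin m) (J : Multiset (Fin n)) :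
    (totalField i z).coord α J = z.coord α (i ::ₘ J) := by
  by_cases h : J.card ≤ r
  · simp [Jet.coord, totalField, h]
  · have h' : ¬ (i ::ₘ J).card ≤ r := by simp; omega
    simp only [Jet.coord, h, h', dite_false]

/-- Total derivatives commute. -/
theorem totalDeriv_comm (i j : Fin n) {F : Jet n m r → ℝ} {z : Jet n m r}
    (hF : ContDiffAt ℝ ∞ F z) :
    totalDeriv i (totalDeriv j F) z = totalDeriv j (totalDeriv i F) z := by
  have h := fderiv_apply_lieBracket (V := totalField i) (W := totalField j) hF minSmoothness_two_le
    (hasFDerivAt_totalField j z).differentiableAt (hasFDerivAt_totalField i z).differentiableAt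
  have h0 : lieBracket ℝ (totalField i) (totalField j) z = 0 := by
    rw [lieBracket_eq]
    simp only [(hasFDerivAt_totalField _ z).fderiv, totalLin_apply, coord_totalField]
    rw [sub_eq_zero]
    simp only [Multiset.cons_swap i j]
  rw [h0, map_zero] at h
  exact (sub_eq_zero.1 h.symm)

/-- The component `ξ_k` of a vector field, as a function on the jet space. -/
def xiJet (V : Base n m → Base n m) (k : Fin n) (y : Jet n m r) : ℝ := (V y.base).1 k

theorem prolongCoeff_cons (V : Base n m → Base n m) (α : Fin m) (i : Fin n) (l : List (Fin n)) :
    (prolongCoeff V α (i :: l) : Jet n m r → ℝ) = fun z =>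
      totalDeriv i (prolongCoeff V α l) z
        - ∑ k : Fin n, totalDeriv i (xiJet V k) z * z.coord α (k ::ₘ (l : Multiset (Fin n))) := rfl

theorem contDiffAt_totalDeriv (i : Fin n) {F : Jet n m r → ℝ} {z : Jet n m r}
    (hF : ContDiffAt ℝ ∞ F z) : ContDiffAt ℝ ∞ (totalDeriv i F) z :=
  (hF.fderiv_right (m := ∞) (by simp)).clm_apply (contDiff_totalField i).contDiffAt

theorem contDiffAt_xiJet {V : Base n m → Base n m} {z : Jet n m r} (hV : ContDiffAt ℝ ∞ V z.base)
    (k : Fin n) : ContDiffAt ℝ ∞ (xiJet V k) z := by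
  have h1 : ContDiffAt ℝ ∞ (fun y : Jet n m r => V y.base) z :=
    ContDiffAt.comp z (f := baseCLM) hV baseCLM.contDiff.contDiffAt
  exact contDiffAt_pi.1 h1.fst k

theorem contDiffAt_prolongCoeff {V : Base n m → Base n m} {z : Jet n m r}
    (hV : ContDiffAt ℝ ∞ V z.base) (α : Fin m) (l : List (Fin n)) :
    ContDiffAt ℝ ∞ (prolongCoeff V α l) z := by
  induction l with
  | nil =>
    have h1 : ContDiffAt ℝ ∞ (fun y : Jet n m r => V y.base) z :=
      ContDiffAt.comp z (f := baseCLM) hV baseCLM.contDiff.contDiffAt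
    exact contDiffAt_pi.1 h1.snd α
  | cons i l ih =>
    rw [prolongCoeff_cons]
    refine (contDiffAt_totalDeriv i ih).sub (ContDiffAt.sum fun k _ => ?_)
    simp only [← coordCLM_apply]
    exact (contDiffAt_totalDeriv i (contDiffAt_xiJet hV k)).mul (coordCLM α _).contDiff.contDiffAt

theorem contDiffAt_prolong {V : Base n m → Base n m} {z : Jet n m r}
    (hV : ContDiffAt ℝ ∞ V z.base) : ContDiffAt ℝ ∞ (prolong V) z :=
  ContDiffAt.prodMk (contDiffAt_pi.2 fun k => contDiffAt_xiJet hV k)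
    (contDiffAt_pi.2 fun α => contDiffAt_pi.2 fun _ => contDiffAt_prolongCoeff hV α _)

theorem fderiv_prolongCoeff_cons {V : Base n m → Base n m} {z : Jet n m r}
    (hV : ContDiffAt ℝ ∞ V z.base) (α : Fin m) (i : Fin n) (l : List (Fin n)) (v : Jet n m r) :
    fderiv ℝ (prolongCoeff V α (i :: l)) z v =
      fderiv ℝ (totalDeriv i (prolongCoeff V α l)) z v
        - ∑ k : Fin n, (fderiv ℝ (totalDeriv i (xiJet V k)) z v
              * z.coord α (k ::ₘ (l : Multiset (Fin n)))
            + totalDeriv i (xiJet V k) z * v.coord α (k ::ₘ (l : Multiset (Fin n)))) := by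
  have h1 := ((contDiffAt_totalDeriv i (contDiffAt_prolongCoeff hV α l)).differentiableAt
    (by simp)).hasFDerivAt
  have h2 : ∀ k, HasFDerivAt (totalDeriv i (xiJet V k)) _ z := fun k =>
    ((contDiffAt_totalDeriv i (contDiffAt_xiJet hV k)).differentiableAt (by simp)).hasFDerivAt
  have h3 := h1.sub (HasFDerivAt.fun_sum (u := Finset.univ) fun k _ =>
    (h2 k).mul (coordCLM (r := r) α (k ::ₘ (l : Multiset (Fin n)))).hasFDerivAt)
  have h4 : (prolongCoeff V α (i :: l) : Jet n m r → ℝ) = totalDeriv i (prolongCoeff V α l)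
      - fun y => ∑ k : Fin n,
          ((totalDeriv i (xiJet V k) : Jet n m r → ℝ) * ⇑(coordCLM (r := r) α (k ::ₘ ↑l))) y := by
    rw [prolongCoeff_cons]
    ext y
    simp [coordCLM_apply]
  rw [h4, h3.fderiv]
  simp only [sub_apply, sum_apply, add_apply, smul_apply, smul_eq_mul,
    coordCLM_apply]
  congr 1
  exact Finset.sum_congr rfl fun k _ => by ring

/-- The prolonged infinitesimals do not depend on the order of the indices. -/
theorem prolongCoeff_perm {M : Set (Base n m)} (hM : IsOpen M) {V : Base n m → Base n m}
    (hV : ContDiffOn ℝ ∞ V M) (α : Fin m) {l l' : List (Fin n)} (hl : l.Perm l') {z : Jet n m r}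
    (hz : z.base ∈ M) : prolongCoeff V α l z = prolongCoeff V α l' z := by
  induction hl generalizing z with
  | nil => rfl
  | @cons i l₁ l₂ h ih =>
    have h1 : prolongCoeff V α l₁ =ᶠ[𝓝 z] prolongCoeff V α l₂ := by
      filter_upwards [(isOpen_base_preimage hM).mem_nhds hz] with y hy
      exact ih hy
    simp only [prolongCoeff_cons, totalDeriv_eq, h1.fderiv_eq, Multiset.coe_eq_coe.2 h]
  | swap i j l =>
    have hVz := hV.contDiffAt (hM.mem_nhds hz)
    rw [congrFun (prolongCoeff_cons V α j (i :: l)) z, congrFun (prolongCoeff_cons V α i (j :: l)) z,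
      totalDeriv_eq j (prolongCoeff V α (i :: l)), totalDeriv_eq i (prolongCoeff V α (j :: l)),
      fderiv_prolongCoeff_cons hVz, fderiv_prolongCoeff_cons hVz]
    -- Unfolded twice, both sides contain `D_i D_j` of lower terms and the sum of `(D_i ξ_k)
    -- u_{J∪{j,k}}` and `(D_j ξ_k) u_{J∪{i,k}}`, which is symmetric in `i` and `j`.
    simp only [← totalDeriv_eq, coord_totalField, ← Multiset.cons_coe]
    rw [totalDeriv_comm j i (contDiffAt_prolongCoeff hVz α l)]
    simp only [totalDeriv_comm j i (contDiffAt_xiJet hVz _), Finset.sum_add_distrib,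
      Multiset.cons_swap _ i, Multiset.cons_swap _ j]
    ring
  | trans _ _ ih1 ih2 => exact (ih1 hz).trans (ih2 hz)

/-- The prolongation is defined through sorted indices; permutation invariance allows any ordering,
in particular a recursion in an arbitrary index. -/
theorem coord_prolong {M : Set (Base n m)} (hM : IsOpen M) {V : Base n m → Base n m}
    (hV : ContDiffOn ℝ ∞ V M) (α : Fin m) {l : List (Fin n)} (hl : l.length ≤ r) {z : Jet n m r}
    (hz : z.base ∈ M) : (prolong V z).coord α l = prolongCoeff V α l z := by
  have h : (l : Multiset (Fin n)).card ≤ r := by simpa using hl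
  rw [Jet.coord, dif_pos h]
  refine prolongCoeff_perm hM hV α ?_ hz
  exact Multiset.coe_eq_coe.1 (Multiset.sort_eq _ _)

/-- A tangent vector to the jet space in the direction of derivatives of order greater than `s`. -/
def HighOrder (s : ℕ) (v : Jet n m r) : Prop :=
  v.1 = 0 ∧ ∀ (α : Fin m) (J : Multiset (Fin n)), J.card ≤ s → v.coord α J = 0

/-- A function of the derivatives of order at most `s`. -/
def OfOrder (s : ℕ) (F : Jet n m r → ℝ) : Prop :=
  ∀ z v : Jet n m r, HighOrder s v → F (z + v) = F z

theorem HighOrder.smul {s : ℕ} {v : Jet n m r} (hv : HighOrder s v) (c : ℝ) :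
    HighOrder s (c • v) := by
  refine ⟨by simp [hv.1], fun α J hJ => ?_⟩
  rw [← coordCLM_apply, map_smul, coordCLM_apply, hv.2 α J hJ, smul_zero]

theorem HighOrder.mono {s t : ℕ} {v : Jet n m r} (hv : HighOrder t v) (h : s ≤ t) :
    HighOrder s v := ⟨hv.1, fun α J hJ => hv.2 α J (hJ.trans h)⟩

theorem HighOrder.base_eq_zero {s : ℕ} {v : Jet n m r} (hv : HighOrder s v) : v.base = 0 := by
  refine Prod.ext hv.1 (funext fun α => ?_)
  have h := hv.2 α 0 (by simp)
  rwa [Jet.coord, dif_pos (by simp)] at h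

theorem HighOrder.totalLin {s : ℕ} {v : Jet n m r} (hv : HighOrder (s + 1) v) (i : Fin n) :
    HighOrder s (totalLin i v) := by
  rw [totalLin_apply]
  refine ⟨rfl, fun α J hJ => ?_⟩
  rw [Jet.coord]
  split_ifs
  · exact hv.2 α _ (by simpa using hJ)
  · rfl

theorem OfOrder.fderiv_apply {s : ℕ} {F : Jet n m r → ℝ} (hF : OfOrder s F) (z : Jet n m r)
    {v : Jet n m r} (hv : HighOrder s v) : fderiv ℝ F z v = 0 := by
  by_cases hd : DifferentiableAt ℝ F z
  · rw [← hd.lineDeriv_eq_fderiv, lineDeriv]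
    simp [fun t : ℝ => hF z (t • v) (hv.smul t)]
  -- Here the default value `0` of `fderiv` is what is wanted.
  · simp [fderiv_zero_of_not_differentiableAt hd]

theorem OfOrder.mono {s t : ℕ} {F : Jet n m r → ℝ} (hF : OfOrder s F) (h : s ≤ t) : OfOrder t F :=
  fun z v hv => hF z v (hv.mono h)

/-- A translation in directions of order above `s + 1` preserves `F` and its derivative, and moves
the field `D_i` only in directions of order above `s`, which the derivative of `F` annihilates. -/
theorem OfOrder.totalDeriv {s : ℕ} {F : Jet n m r → ℝ} (hF : OfOrder s F) (i : Fin n) :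
    OfOrder (s + 1) (totalDeriv i F) := by
  intro z v hv
  have h1 : fderiv ℝ F (z + v) = fderiv ℝ F z := by
    rw [← fderiv_comp_add_right]
    congr 1
    exact funext fun y => hF y v (hv.mono (Nat.le_succ s))
  rw [totalDeriv_eq, totalDeriv_eq, h1, totalField_eq, totalField_eq, map_add (totalLin i),
    ← add_assoc, map_add, hF.fderiv_apply z (hv.totalLin i), add_zero]

theorem ofOrder_xiJet (V : Base n m → Base n m) (k : Fin n) :
    OfOrder 0 (xiJet V k : Jet n m r → ℝ) := by
  intro z v hv
  rw [xiJet, xiJet, ← baseCLM_apply, map_add, baseCLM_apply, baseCLM_apply, hv.base_eq_zero,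
    add_zero]

theorem ofOrder_prolongCoeff (V : Base n m → Base n m) (α : Fin m) (l : List (Fin n)) :
    OfOrder l.length (prolongCoeff V α l : Jet n m r → ℝ) := by
  induction l with
  | nil =>
    intro z v hv
    simp only [prolongCoeff]
    rw [← baseCLM_apply, ← baseCLM_apply, map_add, baseCLM_apply v, hv.base_eq_zero,
      add_zero]
  | cons i l ih =>
    intro z v hv
    simp only [prolongCoeff_cons]
    rw [ih.totalDeriv i z v hv]
    congr 1
    refine Finset.sum_congr rfl fun k _ => ?_
    rw [((ofOrder_xiJet V k).totalDeriv i).mono (by simp) z v hv, ← coordCLM_apply, map_add,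
      coordCLM_apply, coordCLM_apply, hv.2 α _ (by simp), add_zero]

theorem fderiv_prolong_fst {V : Base n m → Base n m} {z : Jet n m r}
    (hV : ContDiffAt ℝ ∞ V z.base) (v : Jet n m r) (k : Fin n) :
    (fderiv ℝ (prolong V) z v).1 k = fderiv ℝ (xiJet V k) z v := by
  have h := ((contDiffAt_prolong hV).differentiableAt (by simp)).hasFDerivAt
  have h1 := (((ContinuousLinearMap.proj k).comp
    (ContinuousLinearMap.fst ℝ (Fin n → ℝ) (JetFibre n m r))).hasFDerivAt.comp z h).fderiv
  exact (congrArg (fun T => T v) h1).symm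

theorem fderiv_prolong_snd {V : Base n m → Base n m} {z : Jet n m r}
    (hV : ContDiffAt ℝ ∞ V z.base) (v : Jet n m r) (α : Fin m) (J : DerivIndex n r) :
    (fderiv ℝ (prolong V) z v).2 α J =
      fderiv ℝ (prolongCoeff V α (J.1.sort (· ≤ ·))) z v := by
  have h := ((contDiffAt_prolong hV).differentiableAt (by simp)).hasFDerivAt
  have h1 := ((((ContinuousLinearMap.proj J).comp (ContinuousLinearMap.proj α)).comp
    (ContinuousLinearMap.snd ℝ (Fin n → ℝ) (JetFibre n m r))).hasFDerivAt.comp z h).fderiv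
  exact (congrArg (fun T => T v) h1).symm

/-- The commutator of a prolonged vector field with a total derivative is
`[V^(r), D_i] = -∑_k (D_i ξ_k) D_k` on functions of order less than `r`. -/
theorem fderiv_totalDeriv_prolong {M : Set (Base n m)} (hM : IsOpen M) {V : Base n m → Base n m}
    (hV : ContDiffOn ℝ ∞ V M) {s : ℕ} (hs : s < r) {F : Jet n m r → ℝ} (hF : OfOrder s F)
    {z : Jet n m r} (hz : z.base ∈ M) (hFz : ContDiffAt ℝ ∞ F z) (i : Fin n) :
    fderiv ℝ (totalDeriv i F) z (prolong V z) =
      totalDeriv i (fun y => fderiv ℝ F y (prolong V y)) z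
        - ∑ k : Fin n, totalDeriv i (xiJet V k) z * totalDeriv k F z := by
  have hVz := hV.contDiffAt (hM.mem_nhds hz)
  have h := fderiv_apply_lieBracket (V := prolong V) (W := totalField i) hFz minSmoothness_two_le
    (hasFDerivAt_totalField i z).differentiableAt
    ((contDiffAt_prolong hVz).differentiableAt (by simp))
  set c : Jet n m r := ∑ k : Fin n, totalDeriv i (xiJet V k) z • totalField k z with hc
  -- The recursion for `η_{α,J∪{i}}` says exactly that these components vanish for `|J| ≤ s`; `s <
  -- r` keeps `J ∪ {i}` inside the jet space. A function of order `s` does not see the rest.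
  have hhigh : HighOrder s (lieBracket ℝ (prolong V) (totalField i) z + c) := by
    have hc1 : ∀ k, c.1 k = totalDeriv i (xiJet V k) z := fun k => by
      simp [hc, Prod.fst_sum, totalField, Finset.sum_apply, Pi.single_apply]
    have hc2 : ∀ α J, c.coord α J =
        ∑ k : Fin n, totalDeriv i (xiJet V k) z * z.coord α (k ::ₘ J) := fun α J => by
      rw [hc, ← coordCLM_apply, map_sum]
      simp [coordCLM_apply, coord_totalField]
    rw [lieBracket_eq]
    simp only [(hasFDerivAt_totalField i z).fderiv]
    constructor
    · ext k
      simp [hc1, fderiv_prolong_fst hVz, totalLin_apply, totalDeriv_eq]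
    · intro α J hJ
      have hJr : J.card ≤ r := hJ.trans hs.le
      have hJ' : (i ::ₘ J).card ≤ r := by simp; omega
      have h1 : (totalLin i (prolong V z)).coord α J = prolongCoeff V α (i :: J.sort (· ≤ ·)) z := by
        rw [totalLin_apply, Jet.coord, dif_pos hJr, ← coord_prolong hM hV α (by simpa using hJ') hz,
          ← Multiset.cons_coe, Multiset.sort_eq]
      have h2 : (fderiv ℝ (prolong V) z (totalField i z)).coord α J =
          totalDeriv i (prolongCoeff V α (J.sort (· ≤ ·))) z := by
        rw [Jet.coord, dif_pos hJr, fderiv_prolong_snd hVz, totalDeriv_eq]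
      rw [← coordCLM_apply, map_add, map_sub, coordCLM_apply, coordCLM_apply, coordCLM_apply, hc2,
        h1, h2, prolongCoeff_cons]
      simp
  have h0 := hF.fderiv_apply z hhigh
  rw [map_add, h, hc, map_sum] at h0
  simp only [map_smul, smul_eq_mul, ← totalDeriv_eq] at h0
  have : fderiv ℝ (totalDeriv i F) z (prolong V z) =
    fderiv ℝ (fun y => fderiv ℝ F y (totalField i y)) z (prolong V z) := rfl
  rw [this]
  linarith

theorem base_prolong (V : Base n m → Base n m) (z : Jet n m r) : (prolong V z).base = V z.base := by
  refine Prod.ext rfl (funext fun α => ?_)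
  simp [Jet.base, prolong, prolongCoeff]

theorem hasFDerivAt_comp_base {V : Base n m → Base n m} {z : Jet n m r}
    (hV : ContDiffAt ℝ ∞ V z.base) : HasFDerivAt (fun y : Jet n m r => V y.base)
      ((fderiv ℝ V z.base).comp baseCLM) z :=
  HasFDerivAt.comp z (f := baseCLM) (hV.differentiableAt (by simp)).hasFDerivAt baseCLM.hasFDerivAt

theorem fderiv_xiJet {V : Base n m → Base n m} {z : Jet n m r}
    (hV : ContDiffAt ℝ ∞ V z.base) (k : Fin n) (v : Jet n m r) :
    fderiv ℝ (xiJet V k) z v = (fderiv ℝ V z.base v.base).1 k := by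
  have h1 := (((ContinuousLinearMap.proj k).comp
    (ContinuousLinearMap.fst ℝ (Fin n → ℝ) (Fin m → ℝ))).hasFDerivAt.comp z
      (hasFDerivAt_comp_base hV)).fderiv
  exact congrArg (fun T => T v) h1

theorem fderiv_prolongCoeff_nil {V : Base n m → Base n m} {z : Jet n m r}
    (hV : ContDiffAt ℝ ∞ V z.base) (α : Fin m) (v : Jet n m r) :
    fderiv ℝ (prolongCoeff V α []) z v = (fderiv ℝ V z.base v.base).2 α := by
  have h1 := (((ContinuousLinearMap.proj α).comp
    (ContinuousLinearMap.snd ℝ (Fin n → ℝ) (Fin m → ℝ))).hasFDerivAt.comp z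
      (hasFDerivAt_comp_base hV)).fderiv
  exact congrArg (fun T => T v) h1

theorem xiJet_lieBracket {V W : Base n m → Base n m} {z : Jet n m r}
    (hV : ContDiffAt ℝ ∞ V z.base) (hW : ContDiffAt ℝ ∞ W z.base) (k : Fin n) :
    xiJet (lieBracket ℝ V W) k z =
      fderiv ℝ (xiJet W k) z (prolong V z) - fderiv ℝ (xiJet V k) z (prolong W z) := by
  rw [fderiv_xiJet hV, fderiv_xiJet hW, base_prolong, base_prolong]
  rfl

/-- Induction on the order: apply `D_i` to the identity for `l` and move it past the prolonged
fields with `fderiv_totalDeriv_prolong`. The commutator terms cancel against those from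
differentiating the factors `u_{α,J∪{k}}` in the recursion. -/
theorem prolongCoeff_lieBracket {M : Set (Base n m)} (hM : IsOpen M) {V W : Base n m → Base n m}
    (hV : ContDiffOn ℝ ∞ V M) (hW : ContDiffOn ℝ ∞ W M) (α : Fin m) {l : List (Fin n)}
    (hl : l.length ≤ r) {z : Jet n m r} (hz : z.base ∈ M) :
    prolongCoeff (lieBracket ℝ V W) α l z =
      fderiv ℝ (prolongCoeff W α l) z (prolong V z)
        - fderiv ℝ (prolongCoeff V α l) z (prolong W z) := by
  induction l generalizing z with
  | nil =>
    have hVz := hV.contDiffAt (hM.mem_nhds hz)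
    have hWz := hW.contDiffAt (hM.mem_nhds hz)
    rw [fderiv_prolongCoeff_nil hVz, fderiv_prolongCoeff_nil hWz, base_prolong, base_prolong]
    rfl
  | cons i l ih =>
    have hlr : l.length < r := by simpa using hl
    have hVz := hV.contDiffAt (hM.mem_nhds hz)
    have hWz := hW.contDiffAt (hM.mem_nhds hz)
    have hnear := (isOpen_base_preimage (r := r) hM).mem_nhds hz
    have hsm : ∀ {U : Base n m → Base n m} {F : Jet n m r → ℝ}, ContDiffAt ℝ ∞ U z.base →
        ContDiffAt ℝ ∞ F z → DifferentiableAt ℝ (fun y => fderiv ℝ F y (prolong U y)) z :=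
      fun hU hF => ((hF.fderiv_right (m := ∞) (by simp)).clm_apply
        (contDiffAt_prolong hU)).differentiableAt (by simp)
    have hD : totalDeriv i (prolongCoeff (lieBracket ℝ V W) α l) z =
        totalDeriv i (fun y => fderiv ℝ (prolongCoeff W α l) y (prolong V y)) z
          - totalDeriv i (fun y => fderiv ℝ (prolongCoeff V α l) y (prolong W y)) z := by
      have h1 : prolongCoeff (lieBracket ℝ V W) α l =ᶠ[𝓝 z] fun y =>
          fderiv ℝ (prolongCoeff W α l) y (prolong V y)
            - fderiv ℝ (prolongCoeff V α l) y (prolong W y) := by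
        filter_upwards [hnear] with y hy
        exact ih hlr.le hy
      rw [totalDeriv_eq, h1.fderiv_eq, fderiv_fun_sub (hsm hVz (contDiffAt_prolongCoeff hWz α l))
        (hsm hWz (contDiffAt_prolongCoeff hVz α l))]
      rfl
    have hX : ∀ k, totalDeriv i (xiJet (lieBracket ℝ V W) k) z =
        totalDeriv i (fun y => fderiv ℝ (xiJet W k) y (prolong V y)) z
          - totalDeriv i (fun y => fderiv ℝ (xiJet V k) y (prolong W y)) z := by
      intro k
      have h1 : xiJet (lieBracket ℝ V W) k =ᶠ[𝓝 z] fun y =>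
          fderiv ℝ (xiJet W k) y (prolong V y) - fderiv ℝ (xiJet V k) y (prolong W y) := by
        filter_upwards [hnear] with y hy
        exact xiJet_lieBracket (hV.contDiffAt (hM.mem_nhds hy)) (hW.contDiffAt (hM.mem_nhds hy)) k
      rw [totalDeriv_eq, h1.fderiv_eq, fderiv_fun_sub (hsm hVz (contDiffAt_xiJet hWz k))
        (hsm hWz (contDiffAt_xiJet hVz k))]
      rfl
    have hcoord : ∀ {U : Base n m → Base n m}, ContDiffOn ℝ ∞ U M → ∀ k,
        (prolong U z).coord α (k ::ₘ (l : Multiset (Fin n))) = prolongCoeff U α (k :: l) z :=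
      fun hU k => by
        rw [Multiset.cons_coe]
        exact coord_prolong hM hU α (by simpa using hl) hz
    rw [prolongCoeff_cons, fderiv_prolongCoeff_cons hVz, fderiv_prolongCoeff_cons hWz]
    simp only [hcoord hV, hcoord hW, hD, hX]
    rw [fderiv_totalDeriv_prolong hM hV hlr (ofOrder_prolongCoeff W α l) hz
        (contDiffAt_prolongCoeff hWz α l),
      fderiv_totalDeriv_prolong hM hW hlr (ofOrder_prolongCoeff V α l) hz
        (contDiffAt_prolongCoeff hVz α l)]
    simp only [fderiv_totalDeriv_prolong hM hV (Nat.zero_lt_of_lt hlr) (ofOrder_xiJet W _) hz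
        (contDiffAt_xiJet hWz _),
      fderiv_totalDeriv_prolong hM hW (Nat.zero_lt_of_lt hlr) (ofOrder_xiJet V _) hz
        (contDiffAt_xiJet hVz _), prolongCoeff_cons]
    simp only [sub_mul, mul_sub, Finset.sum_sub_distrib, Finset.sum_add_distrib, Finset.sum_mul,
      Finset.mul_sum]
    -- The remaining double sums, quadratic in the `D ξ`, agree after exchanging the summation
    -- indices.
    have hsw : ∀ A B : Base n m → Base n m,
        ∑ k : Fin n, ∑ j : Fin n, totalDeriv i (xiJet A j) z * totalDeriv j (xiJet B k) z
            * z.coord α (k ::ₘ (l : Multiset (Fin n)))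
          = ∑ k : Fin n, ∑ j : Fin n, totalDeriv i (xiJet A k) z * (totalDeriv k (xiJet B j) z
            * z.coord α (j ::ₘ (l : Multiset (Fin n)))) := fun A B => by
      rw [Finset.sum_comm]
      simp only [mul_assoc]
    rw [hsw, hsw]
    ring

/-- Prolongation is compatible with Lie brackets. -/
theorem prolong_lieBracket {M : Set (Base n m)} (hM : IsOpen M) {V W : Base n m → Base n m}
    (hV : ContDiffOn ℝ ∞ V M) (hW : ContDiffOn ℝ ∞ W M) {z : Jet n m r} (hz : z.base ∈ M) :
    prolong (lieBracket ℝ V W) z = lieBracket ℝ (prolong V) (prolong W) z := by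
  have hVz := hV.contDiffAt (hM.mem_nhds hz)
  have hWz := hW.contDiffAt (hM.mem_nhds hz)
  rw [lieBracket_eq (V := prolong V)]
  refine Prod.ext (funext fun k => ?_) (funext fun α => funext fun J => ?_)
  · simp only [Prod.fst_sub, Pi.sub_apply, fderiv_prolong_fst hVz, fderiv_prolong_fst hWz]
    exact xiJet_lieBracket hVz hWz k
  · simp only [Prod.snd_sub, Pi.sub_apply, fderiv_prolong_snd hVz, fderiv_prolong_snd hWz]
    exact prolongCoeff_lieBracket hM hV hW α (by simpa using J.2) hz

end Jets

/-! ### Linear combinations and brackets of approximate symmetries. -/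

section Symmetries

open Asymptotics Filter VectorField

variable {n m r q p : ℕ}

theorem contDiffAt_fderiv_slice {A B : Type*} [NormedAddCommGroup A] [NormedSpace ℝ A]
    [NormedAddCommGroup B] [NormedSpace ℝ B] {F : A → ℝ → B} {a : A} {ε : ℝ}
    (hF : ContDiffAt ℝ ∞ (Function.uncurry F) (a, ε)) :
    ContDiffAt ℝ ∞ (fun y : A × ℝ => fderiv ℝ (fun x => F x y.2) y.1) (a, ε) := by
  refine ContDiffAt.fderiv (f := fun (y : A × ℝ) (x : A) => F x y.2) (g := fun y => y.1) (n := ∞)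
    ?_ contDiffAt_fst (by simp)
  exact ContDiffAt.comp ((a, ε), a) (f := fun y : (A × ℝ) × A => (y.2, y.1.2)) hF
    (contDiffAt_snd.prodMk contDiffAt_fst.snd)

theorem contDiffAt_slice {A B : Type*} [NormedAddCommGroup A] [NormedSpace ℝ A]
    [NormedAddCommGroup B] [NormedSpace ℝ B] {F : A → ℝ → B} {a : A} {ε : ℝ}
    (hF : ContDiffAt ℝ ∞ (Function.uncurry F) (a, ε)) : ContDiffAt ℝ ∞ (fun x => F x ε) a :=
  ContDiffAt.comp a (f := fun x => (x, ε)) hF (contDiffAt_id.prodMk contDiffAt_const)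

theorem fderiv_uncurry_inl {A B : Type*} [NormedAddCommGroup A] [NormedSpace ℝ A]
    [NormedAddCommGroup B] [NormedSpace ℝ B] {F : A → ℝ → B} {a : A} {ε : ℝ}
    (hF : ContDiffAt ℝ ∞ (Function.uncurry F) (a, ε)) (v : A) :
    fderiv ℝ (Function.uncurry F) (a, ε) (v, 0) = fderiv ℝ (fun x => F x ε) a v := by
  have h : HasFDerivAt (fun x => Function.uncurry F (x, ε))
      ((fderiv ℝ (Function.uncurry F) (a, ε)).comp (ContinuousLinearMap.inl ℝ A ℝ)) a :=
    HasFDerivAt.comp a (f := fun x => (x, ε)) (hF.differentiableAt (by simp)).hasFDerivAt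
      (hasFDerivAt_prodMk_left a ε)
  exact (congrArg (fun T => T v) h.fderiv).symm

/-- Smoothness for each fixed `ε` is not enough: the estimates run along curves on which the jet and
`ε` vary together. -/
theorem contDiffAt_prolongCoeff_uncurry {Ξ : Generator n m} {z : Jet n m r} {ε : ℝ}
    (hΞ : ContDiffAt ℝ ∞ (Function.uncurry Ξ) (z.base, ε)) (α : Fin m) (l : List (Fin n)) :
    ContDiffAt ℝ ∞ (fun y : Jet n m r × ℝ => prolongCoeff (fun w => Ξ w y.2) α l y.1) (z, ε) := by
  have hbase : ContDiffAt ℝ ∞ (fun y : Jet n m r × ℝ => Ξ y.1.base y.2) (z, ε) :=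
    ContDiffAt.comp (z, ε) (f := fun y : Jet n m r × ℝ => (baseCLM y.1, y.2)) hΞ
      ((baseCLM.contDiff.contDiffAt.comp _ contDiffAt_fst).prodMk contDiffAt_snd)
  have hT : ∀ {F : Jet n m r → ℝ → ℝ} (i : Fin n), ContDiffAt ℝ ∞ (Function.uncurry F) (z, ε) →
      ContDiffAt ℝ ∞ (fun y : Jet n m r × ℝ => totalDeriv i (fun x => F x y.2) y.1) (z, ε) :=
    fun i hF => (contDiffAt_fderiv_slice hF).clm_apply
      ((contDiff_totalField i).contDiffAt.comp _ contDiffAt_fst)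
  induction l with
  | nil => exact contDiffAt_pi.1 hbase.snd α
  | cons i l ih =>
    simp only [prolongCoeff_cons]
    refine (hT (F := fun y ε => prolongCoeff (fun w => Ξ w ε) α l y) i ih).sub (ContDiffAt.sum fun k _ => ?_)
    simp only [← coordCLM_apply]
    exact (hT (F := fun y ε => xiJet (fun w => Ξ w ε) k y) i (contDiffAt_pi.1 hbase.fst k)).mul
      ((coordCLM α _).contDiff.contDiffAt.comp _ contDiffAt_fst)

theorem contDiffAt_prolong_uncurry {Ξ : Generator n m} {z : Jet n m r} {ε : ℝ}
    (hΞ : ContDiffAt ℝ ∞ (Function.uncurry Ξ) (z.base, ε)) :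
    ContDiffAt ℝ ∞ (fun y : Jet n m r × ℝ => prolong (fun w => Ξ w y.2) y.1) (z, ε) := by
  have hbase : ContDiffAt ℝ ∞ (fun y : Jet n m r × ℝ => Ξ y.1.base y.2) (z, ε) :=
    ContDiffAt.comp (z, ε) (f := fun y : Jet n m r × ℝ => (baseCLM y.1, y.2)) hΞ
      ((baseCLM.contDiff.contDiffAt.comp _ contDiffAt_fst).prodMk contDiffAt_snd)
  exact hbase.fst.prodMk (contDiffAt_pi.2 fun α => contDiffAt_pi.2 fun _ =>
    contDiffAt_prolongCoeff_uncurry hΞ α _)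

theorem contDiffAt_prolongedAction {Ξ : Generator n m} {Δ : DiffEq n m r q} {z : Jet n m r} {ε : ℝ}
    (hΞ : ContDiffAt ℝ ∞ (Function.uncurry Ξ) (z.base, ε))
    (hΔ : ContDiffAt ℝ ∞ (Function.uncurry Δ) (z, ε)) :
    ContDiffAt ℝ ∞ (Function.uncurry (prolongedAction Ξ Δ)) (z, ε) :=
  (contDiffAt_fderiv_slice hΔ).clm_apply (contDiffAt_prolong_uncurry hΞ)

theorem Generator.IsSmooth.contDiffAt {Ξ : Generator n m} {M : Set (Base n m)} {E : Set ℝ}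
    (hΞ : Ξ.IsSmooth M E) (hM : IsOpen M) (hE : IsOpen E) {w : Base n m} {ε : ℝ} (hw : w ∈ M)
    (hε : ε ∈ E) : ContDiffAt ℝ ∞ (Function.uncurry Ξ) (w, ε) :=
  ContDiffOn.contDiffAt hΞ ((hM.prod hE).mem_nhds ⟨hw, hε⟩)

theorem Generator.IsSmooth.contDiffOn_slice {Ξ : Generator n m} {M : Set (Base n m)} {E : Set ℝ}
    (hΞ : Ξ.IsSmooth M E) {ε : ℝ} (hε : ε ∈ E) : ContDiffOn ℝ ∞ (fun w => Ξ w ε) M :=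
  ContDiffOn.comp hΞ (contDiffOn_id.prodMk contDiffOn_const) fun _ hw => ⟨hw, hε⟩

/-- The Lie bracket of two generators. -/
def Generator.bracket (Ξ H : Generator n m) : Generator n m :=
  fun w ε => lieBracket ℝ (fun v => Ξ v ε) (fun v => H v ε) w

theorem Generator.IsSmooth.bracket {Ξ H : Generator n m} {M : Set (Base n m)} {E : Set ℝ}
    (hΞ : Ξ.IsSmooth M E) (hH : H.IsSmooth M E) (hM : IsOpen M) (hE : IsOpen E) :
    (Ξ.bracket H).IsSmooth M E := by
  rintro ⟨w, ε⟩ ⟨hw, hε⟩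
  have h1 := hΞ.contDiffAt hM hE hw hε
  have h2 := hH.contDiffAt hM hE hw hε
  exact (((contDiffAt_fderiv_slice h2).clm_apply h1).sub
    ((contDiffAt_fderiv_slice h1).clm_apply h2)).contDiffWithinAt

/-- A linear combination of two generators. -/
def Generator.lincomb (a b : ℝ) (Ξ H : Generator n m) : Generator n m :=
  fun w ε => a • Ξ w ε + b • H w ε

theorem Generator.IsSmooth.lincomb {Ξ H : Generator n m} {M : Set (Base n m)} {E : Set ℝ}
    (hΞ : Ξ.IsSmooth M E) (hH : H.IsSmooth M E) (a b : ℝ) :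
    (Generator.lincomb a b Ξ H).IsSmooth M E :=
  (ContDiffOn.const_smul a hΞ).add (ContDiffOn.const_smul b hH)

theorem Generator.isSmooth_zero (M : Set (Base n m)) (E : Set ℝ) :
    Generator.IsSmooth (0 : Generator n m) M E :=
  contDiffOn_const (c := (0 : Base n m))

theorem prolongCoeff_lincomb {M : Set (Base n m)} (hM : IsOpen M) {V W : Base n m → Base n m}
    (hV : ContDiffOn ℝ ∞ V M) (hW : ContDiffOn ℝ ∞ W M) (a b : ℝ) (α : Fin m) (l : List (Fin n))
    {z : Jet n m r} (hz : z.base ∈ M) :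
    prolongCoeff (fun w => a • V w + b • W w) α l z =
      a * prolongCoeff V α l z + b * prolongCoeff W α l z := by
  have hT : ∀ {F G H : Jet n m r → ℝ} {z : Jet n m r} (i : Fin n),
      (F =ᶠ[𝓝 z] fun y => a * G y + b * H y) → ContDiffAt ℝ ∞ G z → ContDiffAt ℝ ∞ H z →
      totalDeriv i F z = a * totalDeriv i G z + b * totalDeriv i H z := by
    intro F G H z i h hG hH
    have h1 : HasFDerivAt (fun y => a * G y + b * H y) _ z :=
      ((hG.differentiableAt (by simp)).hasFDerivAt.const_mul a).add
      ((hH.differentiableAt (by simp)).hasFDerivAt.const_mul b)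
    rw [totalDeriv_eq, h.fderiv_eq, h1.fderiv]
    rfl
  induction l generalizing z with
  | nil => rfl
  | cons i l ih =>
    have hVz := hV.contDiffAt (hM.mem_nhds hz)
    have hWz := hW.contDiffAt (hM.mem_nhds hz)
    simp only [prolongCoeff_cons]
    rw [hT (G := prolongCoeff V α l) (H := prolongCoeff W α l) i
      (by
        filter_upwards [(isOpen_base_preimage (r := r) hM).mem_nhds hz] with y hy
        exact ih hy)
      (contDiffAt_prolongCoeff hVz α l) (contDiffAt_prolongCoeff hWz α l)]
    have hX : ∀ k, totalDeriv i (xiJet (fun w => a • V w + b • W w) k) z =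
        a * totalDeriv i (xiJet V k) z + b * totalDeriv i (xiJet W k) z := fun k =>
      hT i (Eventually.of_forall fun y => rfl) (contDiffAt_xiJet hVz k) (contDiffAt_xiJet hWz k)
    simp only [hX, mul_sub, Finset.mul_sum, add_mul, Finset.sum_add_distrib, mul_assoc]
    ring

theorem prolong_lincomb {M : Set (Base n m)} (hM : IsOpen M) {V W : Base n m → Base n m}
    (hV : ContDiffOn ℝ ∞ V M) (hW : ContDiffOn ℝ ∞ W M) (a b : ℝ)
    {z : Jet n m r} (hz : z.base ∈ M) :
    prolong (fun w => a • V w + b • W w) z = a • prolong V z + b • prolong W z :=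
  Prod.ext rfl (funext fun α => funext fun _ => prolongCoeff_lincomb hM hV hW a b α _ hz)

theorem expansion_zero {V : Type*} [AddCommGroup V] [Module ℝ V] (v : Fin (p + 1) → V) :
    expansion v 0 = v 0 := by
  rw [expansion, Fin.sum_univ_succ]
  simp

theorem continuous_expansion {V : Type*} [NormedAddCommGroup V] [NormedSpace ℝ V]
    (v : Fin (p + 1) → V) : Continuous (expansion v) := by
  unfold expansion
  fun_prop

theorem tendsto_jet_expansion (x : Fin n → ℝ) (j : Fin (p + 1) → JetFibre n m r) :
    Tendsto (fun ε => ((x, expansion j ε) : Jet n m r)) (𝓝 0) (𝓝 (x, j 0)) := by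
  refine Continuous.tendsto' (continuous_const.prodMk (continuous_expansion j)) _ _ ?_
  rw [expansion_zero]

theorem IsApproxSymmetry.lincomb {M : Set (Base n m)} (hM : IsOpen M) {E : Set ℝ} (hE : IsOpen E)
    (hE0 : (0 : ℝ) ∈ E) {Ω : Set (Jet n m r)} (hΩ : IsOpen Ω) (hΩM : ∀ z ∈ Ω, z.base ∈ M)
    {Δ : DiffEq n m r q} {Ξ H : Generator n m} (hΞ : Ξ.IsSmooth M E) (hH : H.IsSmooth M E)
    (hΞs : IsApproxSymmetry p Ω Δ Ξ) (hHs : IsApproxSymmetry p Ω Δ H) (a b : ℝ) :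
    IsApproxSymmetry p Ω Δ (Generator.lincomb a b Ξ H) := by
  intro x j hj hO
  refine (((hΞs x j hj hO).const_smul_left a).add ((hHs x j hj hO).const_smul_left b)).congr' ?_
    EventuallyEq.rfl
  filter_upwards [(tendsto_jet_expansion x j) (hΩ.mem_nhds hj), hE.mem_nhds hE0] with ε h1 h2
  have h3 := prolong_lincomb hM (hΞ.contDiffOn_slice h2) (hH.contDiffOn_slice h2) a b (hΩM _ h1)
  simp only [prolongedAction, Generator.lincomb, h3, map_add, map_smul]
  rfl

theorem isApproxSymmetry_zero (p : ℕ) (Ω : Set (Jet n m r)) (Δ : DiffEq n m r q) :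
    IsApproxSymmetry p Ω Δ 0 := by
  intro x j _ _
  refine (isBigO_zero _ _).congr_left fun ε => ?_
  -- The zero field is the combination with coefficients `0, 0`, so its prolongation vanishes by
  -- linearity.
  have h := prolong_lincomb (V := fun _ : Base n m => (0 : Base n m)) (W := fun _ => 0)
    (z := ((x, expansion j ε) : Jet n m r)) isOpen_univ contDiffOn_const contDiffOn_const 0 0
    (Set.mem_univ _)
  simp only [zero_smul, add_zero] at h
  simp only [prolongedAction, Pi.zero_apply, h, map_zero]

/-- If `Ξ` and `H` are approximate symmetries, then `Ξ^(r) (H^(r) Δ) ≈ 0` on `Δ ≈ 0`. -/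
theorem IsApproxSymmetry.fderiv_prolongedAction {M : Set (Base n m)} (hM : IsOpen M) {E : Set ℝ}
    (hE : IsOpen E) (hE0 : (0 : ℝ) ∈ E) {Ω : Set (Jet n m r)} (hΩ : IsOpen Ω)
    (hΩM : ∀ z ∈ Ω, z.base ∈ M) {Δ : DiffEq n m r q}
    (hΔ : ContDiffOn ℝ ∞ (Function.uncurry Δ) (Ω ×ˢ E)) (hrank : HasMaximalRank Ω Δ)
    {Ξ H : Generator n m} (hΞ : Ξ.IsSmooth M E) (hH : H.IsSmooth M E)
    (hΞs : IsApproxSymmetry p Ω Δ Ξ) (hHs : IsApproxSymmetry p Ω Δ H)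
    (x : Fin n → ℝ) (j : Fin (p + 1) → JetFibre n m r) (hj : (x, j 0) ∈ Ω)
    (hO : ApproxZero p (fun ε => Δ (x, expansion j ε) ε)) :
    ApproxZero p (fun ε => prolongedAction Ξ (prolongedAction H Δ) (x, expansion j ε) ε) := by
  have hcΔ : ∀ z ∈ Ω, ∀ ε ∈ E, ContDiffAt ℝ ∞ (Function.uncurry Δ) (z, ε) := fun z hz ε hε =>
    hΔ.contDiffAt ((hΩ.prod hE).mem_nhds ⟨hz, hε⟩)
  have hcF : ∀ z ∈ Ω, ∀ ε ∈ E, ContDiffAt ℝ ∞ (Function.uncurry (prolongedAction H Δ)) (z, ε) :=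
    fun z hz ε hε =>
      contDiffAt_prolongedAction (hH.contDiffAt hM hE (hΩM z hz) hε) (hcΔ z hz ε hε)
  have hΔ0 : Δ (x, j 0) 0 = 0 := by
    have := apply_zero_of_isBigO hO
    simpa only [expansion_zero] using this
  have hle : ∀ k : ℕ, (k : ℕ∞ω) ≤ ∞ := fun k => WithTop.coe_le_coe.2 le_top
  have hζ := tendsto_jet_expansion x j
  have hnear : ∀ᶠ ε in 𝓝 (0 : ℝ), ((x, expansion j ε) : Jet n m r) ∈ Ω ∧ ε ∈ E :=
    (hζ.eventually (hΩ.mem_nhds hj)).and (hE.mem_nhds hE0)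
  have hv : (fun ε => prolong (fun w => Ξ w ε) ((x, expansion j ε) : Jet n m r)) =O[𝓝 0]
      fun _ => (1 : ℝ) := by
    have h1 := (contDiffAt_prolong_uncurry (hΞ.contDiffAt hM hE (hΩM _ hj) hE0)).continuousAt
    exact (h1.tendsto.comp (hζ.prodMk_nhds tendsto_id)).isBigO_one ℝ
  have key := fderiv_isBigO_of_isBigO_on_solutions (p := p + 1) (D := Function.uncurry Δ)
    (F := Function.uncurry (prolongedAction H Δ)) (z₀ := (x, j 0))
    ((hcΔ _ hj _ hE0).of_le (hle _)) ((hcF _ hj _ hE0).of_le (hle _)) hΔ0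
    (by simpa only [fderiv_uncurry_inl (hcΔ _ hj _ hE0)] using hrank _ hj hΔ0) ?_ hζ hO hv ?_
  · refine key.congr' ?_ EventuallyEq.rfl
    filter_upwards [hnear] with ε hε
    exact fderiv_uncurry_inl (hcF _ hε.1 _ hε.2) _
  -- The symmetry condition speaks of polynomial curves only. Replacing `y` by its Taylor polynomial
  -- of degree `p` changes `Δ` and `H^(r) Δ` by `O(ε^{p+1})`.
  · filter_upwards [hΩ.mem_nhds hj] with z hz y hy hy0 hyO
    have hexp : ∀ ε, expansion (fun k : Fin (p + 1) => taylorCoeff k y) ε =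
        ∑ k ∈ Finset.range (p + 1), ε ^ k • taylorCoeff k y := fun ε =>
      Fin.sum_univ_eq_sum_range (fun k => ε ^ k • taylorCoeff k y) (p + 1)
    have htay := sub_taylor_isBigO (p + 1) hy
    simp only [← hexp] at htay
    have hz0 : ((z.1, taylorCoeff ((0 : Fin (p + 1)) : ℕ) y) : Jet n m r) = z := by
      rw [Fin.val_zero, taylorCoeff_zero, hy0]
    have hy' : Tendsto (fun ε => ((z.1, y ε) : Jet n m r)) (𝓝 0) (𝓝 z) := by
      have := (tendsto_const_nhds (x := z.1)).prodMk_nhds hy.continuousAt.tendsto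
      rwa [hy0] at this
    have ht' : Tendsto (fun ε => ((z.1, expansion (fun k : Fin (p + 1) => taylorCoeff k y) ε) :
        Jet n m r)) (𝓝 0) (𝓝 z) := by
      have := tendsto_jet_expansion z.1 (fun k : Fin (p + 1) => taylorCoeff k y)
      rwa [hz0] at this
    have hsub : (fun ε : ℝ => (((z.1, y ε) : Jet n m r), ε)
        - ((z.1, expansion (fun k : Fin (p + 1) => taylorCoeff k y) ε), ε)) =O[𝓝 0]
        fun ε : ℝ => ε ^ (p + 1) := by
      refine IsBigO.of_norm_left (htay.norm_left.congr_left fun ε => ?_)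
      simp [Prod.norm_def]
    have hsubG : ∀ {G : DiffEq n m r q}, ContDiffAt ℝ ∞ (Function.uncurry G) (z, 0) →
        (fun ε => G (z.1, y ε) ε
          - G (z.1, expansion (fun k : Fin (p + 1) => taylorCoeff k y) ε) ε) =O[𝓝 0]
          fun ε : ℝ => ε ^ (p + 1) := fun hG =>
      isBigO_comp_sub_comp (hG.of_le (hle 1)) (hy'.prodMk_nhds tendsto_id)
        (ht'.prodMk_nhds tendsto_id) hsub
    have h1 : ApproxZero p (fun ε =>
        Δ (z.1, expansion (fun k : Fin (p + 1) => taylorCoeff k y) ε) ε) := by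
      refine (hyO.sub (hsubG (hcΔ z hz 0 hE0))).congr_left fun ε => ?_
      exact sub_sub_cancel _ _
    have h2 := hHs z.1 (fun k => taylorCoeff k y) (by rwa [hz0]) h1
    refine (IsBigO.add h2 (hsubG (hcF z hz 0 hE0))).congr_left fun ε => ?_
    exact add_sub_cancel _ _
  -- The symmetry `Ξ` enters only here: its prolongation is approximately tangent to the solutions.
  · refine IsBigO.congr' (hΞs x j hj hO) ?_ EventuallyEq.rfl
    filter_upwards [hnear] with ε hε
    exact (fderiv_uncurry_inl (hcΔ _ hε.1 _ hε.2) _).symm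

/-- The Lie bracket of two approximate symmetries is an approximate symmetry. -/
theorem IsApproxSymmetry.bracket {M : Set (Base n m)} (hM : IsOpen M) {E : Set ℝ}
    (hE : IsOpen E) (hE0 : (0 : ℝ) ∈ E) {Ω : Set (Jet n m r)} (hΩ : IsOpen Ω)
    (hΩM : ∀ z ∈ Ω, z.base ∈ M) {Δ : DiffEq n m r q}
    (hΔ : ContDiffOn ℝ ∞ (Function.uncurry Δ) (Ω ×ˢ E)) (hrank : HasMaximalRank Ω Δ)
    {Ξ H : Generator n m} (hΞ : Ξ.IsSmooth M E) (hH : H.IsSmooth M E)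
    (hΞs : IsApproxSymmetry p Ω Δ Ξ) (hHs : IsApproxSymmetry p Ω Δ H) :
    IsApproxSymmetry p Ω Δ (Ξ.bracket H) := by
  intro x j hj hO
  have h1 := IsApproxSymmetry.fderiv_prolongedAction hM hE hE0 hΩ hΩM hΔ hrank hΞ hH hΞs hHs
    x j hj hO
  have h2 := IsApproxSymmetry.fderiv_prolongedAction hM hE hE0 hΩ hΩM hΔ hrank hH hΞ hHs hΞs
    x j hj hO
  refine (IsBigO.sub h1 h2).congr' ?_ EventuallyEq.rfl
  filter_upwards [(tendsto_jet_expansion x j) (hΩ.mem_nhds hj), hE.mem_nhds hE0] with ε hε hεE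
  have hb := hΩM _ hε
  have hcΔ := contDiffAt_slice (hΔ.contDiffAt ((hΩ.prod hE).mem_nhds ⟨hε, hεE⟩))
  have hΞε := hΞ.contDiffOn_slice hεE
  have hHε := hH.contDiffOn_slice hεE
  have h3 := fderiv_apply_lieBracket (V := prolong fun w => Ξ w ε) (W := prolong fun w => H w ε)
    hcΔ minSmoothness_two_le
    ((contDiffAt_prolong (hHε.contDiffAt (hM.mem_nhds hb))).differentiableAt (by simp))
    ((contDiffAt_prolong (hΞε.contDiffAt (hM.mem_nhds hb))).differentiableAt (by simp))
  rw [← prolong_lieBracket hM hΞε hHε hb] at h3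
  exact h3.symm

end Symmetries

/-! ### Approximate generators as Taylor coefficients; transport of the Lie bracket. -/

section Expansions

open Asymptotics Filter VectorField

variable {n m p : ℕ}

/-- The map `(x, u_(0), …, u_(p)) ↦ (x, ∑_k ε^k u_(k))`. -/
def insertExpansion (ε : ℝ) : ExpandedBase n m p →L[ℝ] Base n m :=
  (ContinuousLinearMap.fst ℝ _ _).prod
    (∑ k : Fin (p + 1), ε ^ (k : ℕ) •
      (ContinuousLinearMap.proj (R := ℝ) (φ := fun _ : Fin (p + 1) => Fin m → ℝ) k).comp
        (ContinuousLinearMap.snd ℝ (Fin n → ℝ) (Fin (p + 1) → Fin m → ℝ)))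

theorem insertExpansion_apply (ε : ℝ) (w : ExpandedBase n m p) :
    insertExpansion ε w = (w.1, expansion w.2 ε) := by
  simp [insertExpansion, expansion, sum_apply]

/-- The inclusion `(a, b) ↦ (a, b, 0, …, 0)`. -/
def leadingInclusion : Base n m →L[ℝ] ExpandedBase n m p :=
  (ContinuousLinearMap.fst ℝ _ _).prod
    ((ContinuousLinearMap.single ℝ (fun _ : Fin (p + 1) => Fin m → ℝ) 0).comp
      (ContinuousLinearMap.snd ℝ _ _))

theorem leadingInclusion_apply (v : Base n m) :
    (leadingInclusion v : ExpandedBase n m p) = (v.1, Pi.single 0 v.2) := rfl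

/-- This is why derivatives with respect to `u_(0)` reproduce those with respect to `u`: only
`u_(0)` carries the factor `ε^0`. -/
theorem insertExpansion_leadingInclusion (ε : ℝ) (v : Base n m) :
    insertExpansion ε (leadingInclusion v : ExpandedBase n m p) = v := by
  rw [insertExpansion_apply, leadingInclusion_apply, expansion]
  refine Prod.ext rfl ?_
  rw [Finset.sum_eq_single 0] <;> simp +contextual

theorem contDiff_insertExpansion {k : ℕ∞ω} : ContDiff ℝ k
    (fun y : ExpandedBase n m p × ℝ => (((y.1.1, expansion y.1.2 y.2) : Base n m), y.2)) := by
  unfold expansion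
  fun_prop

variable {M : Set (Base n m)} {E : Set ℝ}

/-- A generator with the expansion of the dependent variables inserted. -/
def Generator.inserted (p : ℕ) (Ξ : Generator n m) (y : ExpandedBase n m p × ℝ) : Base n m :=
  Ξ (y.1.1, expansion y.1.2 y.2) y.2

theorem Generator.expand_apply (Ξ : Generator n m) (k : Fin (p + 1)) {w : ExpandedBase n m p}
    (hw : (w.1, w.2 0) ∈ M) :
    Ξ.expand p M k w = taylorCoeff k (fun ε => Ξ.inserted p (w, ε)) := by
  rw [Generator.expand, if_pos hw]
  rfl

theorem Generator.expand_apply_of_notMem (Ξ : Generator n m) (k : Fin (p + 1))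
    {w : ExpandedBase n m p} (hw : (w.1, w.2 0) ∉ M) : Ξ.expand p M k w = 0 := by
  rw [Generator.expand, if_neg hw]

theorem eventually_inserted_mem (hM : IsOpen M) (hE : IsOpen E) (hE0 : (0 : ℝ) ∈ E)
    {w : ExpandedBase n m p} (hw : (w.1, w.2 0) ∈ M) :
    ∀ᶠ ε in 𝓝 (0 : ℝ), ((w.1, expansion w.2 ε) : Base n m) ∈ M ∧ ε ∈ E := by
  have h : Tendsto (fun ε => ((w.1, expansion w.2 ε) : Base n m)) (𝓝 0) (𝓝 (w.1, w.2 0)) := by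
    refine Continuous.tendsto' (continuous_const.prodMk (continuous_expansion w.2)) _ _ ?_
    rw [expansion_zero]
  exact (h.eventually (hM.mem_nhds hw)).and (hE.mem_nhds hE0)

theorem Generator.IsSmooth.contDiffAt_inserted {Ξ : Generator n m} (hΞ : Ξ.IsSmooth M E)
    (hM : IsOpen M) (hE : IsOpen E) {w : ExpandedBase n m p} {ε : ℝ}
    (hw : (w.1, expansion w.2 ε) ∈ M) (hε : ε ∈ E) (k : ℕ) :
    ContDiffAt ℝ k (Ξ.inserted p) (w, ε) := by
  have h := ContDiffAt.comp (w, ε) (hΞ.contDiffAt hM hE hw hε)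
    (contDiff_insertExpansion (p := p)).contDiffAt
  exact h.of_le (WithTop.coe_le_coe.2 le_top)

theorem Generator.IsSmooth.contDiffAt_inserted_zero {Ξ : Generator n m} (hΞ : Ξ.IsSmooth M E)
    (hM : IsOpen M) (hE : IsOpen E) (hE0 : (0 : ℝ) ∈ E) {w : ExpandedBase n m p}
    (hw : (w.1, w.2 0) ∈ M) (k : ℕ) : ContDiffAt ℝ k (Ξ.inserted p) (w, 0) :=
  hΞ.contDiffAt_inserted hM hE (by rwa [expansion_zero]) hE0 k

/-- For small `ε` the inserted expansion stays in `M × E`, so identities of generators valid there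
pass to approximate generators. -/
theorem Generator.expand_congr {Ξ H : Generator n m} (hM : IsOpen M) (hE : IsOpen E)
    (hE0 : (0 : ℝ) ∈ E) (h : ∀ w ∈ M, ∀ ε ∈ E, Ξ w ε = H w ε) : Ξ.expand p M = H.expand p M := by
  ext1 k
  ext1 w
  by_cases hw : (w.1, w.2 0) ∈ M
  · rw [Ξ.expand_apply k hw, H.expand_apply k hw]
    refine taylorCoeff_congr ?_ k
    filter_upwards [eventually_inserted_mem hM hE hE0 hw] with ε hε
    exact h _ hε.1 _ hε.2
  · rw [Ξ.expand_apply_of_notMem k hw, H.expand_apply_of_notMem k hw]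

theorem Generator.expand_lincomb {Ξ H : Generator n m} (hM : IsOpen M) (hE : IsOpen E)
    (hE0 : (0 : ℝ) ∈ E) (hΞ : Ξ.IsSmooth M E) (hH : H.IsSmooth M E) (a b : ℝ) :
    (Generator.lincomb a b Ξ H).expand p M = a • Ξ.expand p M + b • H.expand p M := by
  ext1 k
  ext1 w
  simp only [Pi.add_apply, Pi.smul_apply]
  by_cases hw : (w.1, w.2 0) ∈ M
  · rw [expand_apply _ k hw, expand_apply _ k hw, expand_apply _ k hw]
    have h1 := contDiffAt_prodMk_right (hΞ.contDiffAt_inserted_zero hM hE hE0 hw k)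
    have h2 := contDiffAt_prodMk_right (hH.contDiffAt_inserted_zero hM hE hE0 hw k)
    rw [← taylorCoeff_const_smul h1, ← taylorCoeff_const_smul h2,
      ← taylorCoeff_add (h1.const_smul a) (h2.const_smul b)]
    rfl
  · simp [expand_apply_of_notMem _ k hw]

theorem Generator.expand_zero (hM : IsOpen M) (hE : IsOpen E) (hE0 : (0 : ℝ) ∈ E) :
    (0 : Generator n m).expand p M = 0 := by
  have h := Generator.expand_lincomb (p := p) hM hE hE0 (Generator.isSmooth_zero M E)
    (Generator.isSmooth_zero M E) 0 0
  simp only [zero_smul, add_zero] at h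
  rw [← h]
  exact Generator.expand_congr hM hE hE0 fun w _ ε _ => by simp [Generator.lincomb]

theorem sum_fin_ite_eq_sum_antidiagonal {A : Type*} [AddCommMonoid A] (k : Fin (p + 1))
    (f : ℕ → ℕ → A) :
    (∑ i : Fin (p + 1), ∑ j : Fin (p + 1), if (i : ℕ) + j = k then f i j else 0) =
      ∑ ij ∈ Finset.HasAntidiagonal.antidiagonal (k : ℕ), f ij.1 ij.2 := by
  have h1 : ∀ i : ℕ, (∑ j : Fin (p + 1), if i + j = k then f i j else 0) =
      ∑ j ∈ Finset.range (p + 1), if i + j = k then f i j else 0 := fun i =>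
    Fin.sum_univ_eq_sum_range (fun j => if i + j = (k : ℕ) then f i j else 0) (p + 1)
  simp only [h1]
  rw [Fin.sum_univ_eq_sum_range
      (fun i => ∑ j ∈ Finset.range (p + 1), if i + j = (k : ℕ) then f i j else 0) (p + 1),
    ← Finset.sum_product', ← Finset.sum_filter]
  refine Finset.sum_congr ?_ fun _ _ => rfl
  ext ⟨i, j⟩
  have := k.2
  simp only [Finset.mem_filter, Finset.mem_product, Finset.mem_range,
    Finset.HasAntidiagonal.mem_antidiagonal]
  omega

theorem fderiv_expand {Ξ : Generator n m} (hM : IsOpen M) (hE : IsOpen E) (hE0 : (0 : ℝ) ∈ E)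
    (hΞ : Ξ.IsSmooth M E) (k : Fin (p + 1)) {w : ExpandedBase n m p} (hw : (w.1, w.2 0) ∈ M) :
    fderiv ℝ (Ξ.expand p M k) w = taylorCoeff k fun ε =>
      (fderiv ℝ (Ξ.inserted p) (w, ε)).comp (ContinuousLinearMap.inl ℝ (ExpandedBase n m p) ℝ) := by
  refine ((hasFDerivAt_taylorCoeff
    (hΞ.contDiffAt_inserted_zero hM hE hE0 hw _)).congr_of_eventuallyEq ?_).fderiv
  have hopen : IsOpen {v : ExpandedBase n m p | (v.1, v.2 0) ∈ M} :=
    hM.preimage (by fun_prop)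
  filter_upwards [hopen.mem_nhds hw] with v hv
  exact Ξ.expand_apply k hv

/-- Leibniz rule for the pairing of a vector with a linear map, after exchanging Taylor coefficients
with derivatives; the chain rule through `insertExpansion` then identifies the paired function. -/
theorem sum_dirDeriv_expand {Ξ H : Generator n m} (hM : IsOpen M) (hE : IsOpen E)
    (hE0 : (0 : ℝ) ∈ E) (hΞ : Ξ.IsSmooth M E) (hH : H.IsSmooth M E) (k : Fin (p + 1))
    {w : ExpandedBase n m p} (hw : (w.1, w.2 0) ∈ M) :
    (∑ i : Fin (p + 1), ∑ j : Fin (p + 1),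
      if (i : ℕ) + j = k then dirDeriv (Ξ.expand p M i) (H.expand p M j) w else 0) =
    taylorCoeff k fun ε => fderiv ℝ (fun v => H v ε) (w.1, expansion w.2 ε)
      (Ξ (w.1, expansion w.2 ε) ε) := by
  let B : Base n m →L[ℝ] (ExpandedBase n m p →L[ℝ] Base n m) →L[ℝ] Base n m :=
    ((ContinuousLinearMap.compL ℝ (Base n m) (ExpandedBase n m p) (Base n m)).flip
      leadingInclusion).flip
  have hB : ∀ v T, B v T = T (leadingInclusion v) := fun v T => rfl
  have hcd : ∀ k : ℕ, ContDiffAt ℝ k (fun ε => (fderiv ℝ (H.inserted p) (w, ε)).comp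
      (ContinuousLinearMap.inl ℝ (ExpandedBase n m p) ℝ)) 0 := fun k => by
    have h1 := (hH.contDiffAt_inserted_zero hM hE hE0 hw (k + 1)).fderiv_right
      (m := k) (by norm_cast)
    exact (contDiffAt_prodMk_right h1).clm_comp contDiffAt_const
  have h1 : ∀ i j : Fin (p + 1), dirDeriv (Ξ.expand p M i) (H.expand p M j) w =
      B (taylorCoeff i fun ε => Ξ.inserted p (w, ε)) (taylorCoeff j fun ε =>
        (fderiv ℝ (H.inserted p) (w, ε)).comp
          (ContinuousLinearMap.inl ℝ (ExpandedBase n m p) ℝ)) := fun i j => by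
    rw [dirDeriv, fderiv_expand hM hE hE0 hH j hw, Ξ.expand_apply i hw, hB]
    rfl
  simp only [h1]
  rw [sum_fin_ite_eq_sum_antidiagonal k (fun i j => B (taylorCoeff i fun ε => Ξ.inserted p (w, ε))
      (taylorCoeff j fun ε => (fderiv ℝ (H.inserted p) (w, ε)).comp
        (ContinuousLinearMap.inl ℝ (ExpandedBase n m p) ℝ))),
    ← taylorCoeff_bilinear B (contDiffAt_prodMk_right
      (hΞ.contDiffAt_inserted_zero hM hE hE0 hw k)) (hcd k)]
  refine taylorCoeff_congr ?_ k
  filter_upwards [eventually_inserted_mem hM hE hE0 hw] with ε hε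
  have h2 : HasFDerivAt (fun v : ExpandedBase n m p => H.inserted p (v, ε))
      ((fderiv ℝ (H.inserted p) (w, ε)).comp
        (ContinuousLinearMap.inl ℝ (ExpandedBase n m p) ℝ)) w :=
    HasFDerivAt.comp w (f := fun v => (v, ε))
      ((hH.contDiffAt_inserted hM hE hε.1 hε.2 1).differentiableAt (by simp)).hasFDerivAt
      (hasFDerivAt_prodMk_left w ε)
  have h3 : (fun v : ExpandedBase n m p => H.inserted p (v, ε)) =
      fun v => (fun u => H u ε) (insertExpansion ε v) := by
    ext1 v
    rw [insertExpansion_apply]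
    rfl
  have h4 : HasFDerivAt (fun v : ExpandedBase n m p => (fun u => H u ε) (insertExpansion ε v))
      ((fderiv ℝ (fun u => H u ε) (insertExpansion ε w)).comp (insertExpansion ε)) w := by
    have h5 : DifferentiableAt ℝ (fun u => H u ε) (insertExpansion ε w) := by
      rw [insertExpansion_apply]
      exact (contDiffAt_slice (hH.contDiffAt hM hE hε.1 hε.2)).differentiableAt (by simp)
    exact h5.hasFDerivAt.comp w (insertExpansion ε).hasFDerivAt
  rw [h3] at h2
  rw [hB, h2.unique h4, ContinuousLinearMap.comp_apply, insertExpansion_leadingInclusion,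
    insertExpansion_apply]
  rfl

theorem approxBracket_swap (G H : ApproxGenerator n m p) :
    approxBracket G H = -approxBracket H G := by
  ext1 k
  ext1 w
  simp only [approxBracket, Pi.neg_apply]
  rw [Finset.sum_comm, ← Finset.sum_neg_distrib]
  refine Finset.sum_congr rfl fun i _ => ?_
  rw [← Finset.sum_neg_distrib]
  refine Finset.sum_congr rfl fun j _ => ?_
  rw [add_comm (j : ℕ)]
  split_ifs <;> simp

theorem approxBracket_self (G : ApproxGenerator n m p) : approxBracket G G = 0 := by
  ext1 k
  ext1 w
  have h := congrFun (congrFun (approxBracket_swap G G) k) w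
  refine Prod.ext (funext fun i => ?_) (funext fun α => ?_)
  · have h1 := congrArg (fun v : Base n m => v.1 i) h
    simp only [Pi.neg_apply, Prod.fst_neg] at h1
    simpa using self_eq_neg.1 h1
  · have h1 := congrArg (fun v : Base n m => v.2 α) h
    simp only [Pi.neg_apply, Prod.snd_neg] at h1
    simpa using self_eq_neg.1 h1

/-- The approximate Lie bracket of the approximate generators of `Ξ` and `H` is the approximate
generator of `[Ξ, H]`. -/
theorem approxBracket_expand {Ξ H : Generator n m} (hM : IsOpen M) (hE : IsOpen E)
    (hE0 : (0 : ℝ) ∈ E) (hΞ : Ξ.IsSmooth M E) (hH : H.IsSmooth M E) :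
    approxBracket (Ξ.expand p M) (H.expand p M) = (Ξ.bracket H).expand p M := by
  ext1 k
  ext1 w
  by_cases hw : (w.1, w.2 0) ∈ M
  · have hsplit : approxBracket (Ξ.expand p M) (H.expand p M) k w =
        (∑ i : Fin (p + 1), ∑ j : Fin (p + 1),
          if (i : ℕ) + j = k then dirDeriv (Ξ.expand p M i) (H.expand p M j) w else 0)
        - ∑ j : Fin (p + 1), ∑ i : Fin (p + 1),
          if (j : ℕ) + i = k then dirDeriv (H.expand p M j) (Ξ.expand p M i) w else 0 := by
      rw [Finset.sum_comm (f := fun j i : Fin (p + 1) =>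
        if (j : ℕ) + i = k then dirDeriv (H.expand p M j) (Ξ.expand p M i) w else 0)]
      simp only [approxBracket, ← Finset.sum_sub_distrib]
      refine Finset.sum_congr rfl fun i _ => Finset.sum_congr rfl fun j _ => ?_
      rw [add_comm (j : ℕ)]
      split_ifs <;> simp
    have hcd : ∀ {A B : Generator n m}, A.IsSmooth M E → B.IsSmooth M E →
        ContDiffAt ℝ (k : ℕ) (fun ε => fderiv ℝ (fun v => B v ε) (w.1, expansion w.2 ε)
          (A (w.1, expansion w.2 ε) ε)) 0 := fun {A B} hA hB => by
      have hw' : ((w.1, expansion w.2 0) : Base n m) ∈ M := by rwa [expansion_zero]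
      have h1 := (contDiffAt_fderiv_slice (hB.contDiffAt hM hE hw' hE0)).clm_apply
        (hA.contDiffAt hM hE hw' hE0)
      have h2 := ContDiffAt.comp (w, (0 : ℝ)) h1
        (contDiff_insertExpansion (p := p)).contDiffAt
      exact (contDiffAt_prodMk_right h2).of_le (WithTop.coe_le_coe.2 le_top)
    rw [hsplit, sum_dirDeriv_expand hM hE hE0 hΞ hH k hw,
      sum_dirDeriv_expand hM hE hE0 hH hΞ k hw, Generator.expand_apply _ k hw,
      ← taylorCoeff_sub (hcd hΞ hH) (hcd hH hΞ)]
    rfl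
  · rw [Generator.expand_apply_of_notMem _ k hw]
    -- Off the domain both directions of differentiation are zero, so the values of the derivatives,
    -- even at boundary points, do not matter.
    refine Finset.sum_eq_zero fun i _ => Finset.sum_eq_zero fun j _ => ?_
    have h0 : ((0 : Fin n → ℝ), (Pi.single 0 0 : Fin (p + 1) → Fin m → ℝ)) = 0 := by simp
    simp only [dirDeriv, Generator.expand_apply_of_notMem _ _ hw, Prod.fst_zero, Prod.snd_zero, h0,
      map_zero, sub_zero, ite_self]

/-- Linearity of `fderiv` requires differentiability, so it is taken from the Lie bracket of smooth
generators at each `ε`. -/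
theorem approxBracket_lincomb_left {Ξ H K : Generator n m} (hM : IsOpen M) (hE : IsOpen E)
    (hE0 : (0 : ℝ) ∈ E) (hΞ : Ξ.IsSmooth M E) (hH : H.IsSmooth M E) (hK : K.IsSmooth M E)
    (a b : ℝ) :
    approxBracket (a • Ξ.expand p M + b • H.expand p M) (K.expand p M) =
      a • approxBracket (Ξ.expand p M) (K.expand p M)
        + b • approxBracket (H.expand p M) (K.expand p M) := by
  rw [← Generator.expand_lincomb hM hE hE0 hΞ hH,
    approxBracket_expand hM hE hE0 (hΞ.lincomb hH a b) hK, approxBracket_expand hM hE hE0 hΞ hK,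
    approxBracket_expand hM hE hE0 hH hK,
    ← Generator.expand_lincomb hM hE hE0 (hΞ.bracket hK hM hE) (hH.bracket hK hM hE)]
  refine Generator.expand_congr hM hE hE0 fun w hw ε hε => ?_
  have hd : ∀ {A : Generator n m}, A.IsSmooth M E → DifferentiableAt ℝ (fun v => A v ε) w :=
    fun hA => (contDiffAt_slice (hA.contDiffAt hM hE hw hε)).differentiableAt (by simp)
  have h1 := lieBracket_add_left (W := fun v => K v ε) ((hd hΞ).const_smul a)
    ((hd hH).const_smul b)
  rw [lieBracket_const_smul_left (hd hΞ), lieBracket_const_smul_left (hd hH)] at h1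
  exact h1

theorem approxBracket_lincomb_right {Ξ H K : Generator n m} (hM : IsOpen M) (hE : IsOpen E)
    (hE0 : (0 : ℝ) ∈ E) (hΞ : Ξ.IsSmooth M E) (hH : H.IsSmooth M E) (hK : K.IsSmooth M E)
    (a b : ℝ) :
    approxBracket (K.expand p M) (a • Ξ.expand p M + b • H.expand p M) =
      a • approxBracket (K.expand p M) (Ξ.expand p M)
        + b • approxBracket (K.expand p M) (H.expand p M) := by
  rw [approxBracket_swap, approxBracket_lincomb_left hM hE hE0 hΞ hH hK,
    approxBracket_swap (K.expand p M) (Ξ.expand p M),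
    approxBracket_swap (K.expand p M) (H.expand p M), smul_neg, smul_neg, neg_add]

theorem approxBracket_leibniz {Ξ H K : Generator n m} (hM : IsOpen M) (hE : IsOpen E)
    (hE0 : (0 : ℝ) ∈ E) (hΞ : Ξ.IsSmooth M E) (hH : H.IsSmooth M E) (hK : K.IsSmooth M E) :
    approxBracket (Ξ.expand p M) (approxBracket (H.expand p M) (K.expand p M)) =
      approxBracket (approxBracket (Ξ.expand p M) (H.expand p M)) (K.expand p M)
        + approxBracket (H.expand p M) (approxBracket (Ξ.expand p M) (K.expand p M)) := by
  have hΞH := hΞ.bracket hH hM hE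
  have hΞK := hΞ.bracket hK hM hE
  have hHK := hH.bracket hK hM hE
  rw [approxBracket_expand hM hE hE0 hH hK, approxBracket_expand hM hE hE0 hΞ hHK,
    approxBracket_expand hM hE hE0 hΞ hH, approxBracket_expand hM hE hE0 hΞH hK,
    approxBracket_expand hM hE hE0 hΞ hK, approxBracket_expand hM hE hE0 hH hΞK]
  have h := Generator.expand_lincomb (p := p) hM hE hE0 (hΞH.bracket hK hM hE)
    (hH.bracket hΞK hM hE) 1 1
  rw [one_smul, one_smul] at h
  rw [← h]
  refine Generator.expand_congr hM hE hE0 fun w hw ε hε => ?_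
  have hc : ∀ {A : Generator n m}, A.IsSmooth M E → ContDiffAt ℝ ∞ (fun v => A v ε) w :=
    fun hA => contDiffAt_slice (hA.contDiffAt hM hE hw hε)
  have h1 := leibniz_identity_lieBracket (𝕜 := ℝ) minSmoothness_two_le (hc hΞ) (hc hH) (hc hK)
  simp only [Generator.lincomb, one_smul]
  exact h1

end Expansions

end ApproxLie

end

/-! ### The approximate Lie algebra of symmetries. -/

open ApproxLie

theorem mainTheorem5 {n m r q : ℕ} (p : ℕ)
    (M : Set (ApproxLie.Base n m)) (hM : IsOpen M)
    (E : Set ℝ) (hE : IsOpen E) (hE0 : (0 : ℝ) ∈ E)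
    (Ω : Set (ApproxLie.Jet n m r)) (hΩ : IsOpen Ω)
    (hΩM : ∀ z ∈ Ω, ApproxLie.Jet.base z ∈ M)
    (Δ : ApproxLie.DiffEq n m r q)
    (hΔ : ContDiffOn ℝ ∞ (Function.uncurry Δ) (Ω ×ˢ E))
    (hrank : ApproxLie.HasMaximalRank Ω Δ) :
    ApproxLie.IsApproxLieAlgebra (ApproxLie.approxSymmetries p M E Ω Δ) := by
  have hlin : ∀ (a b : ℝ), ∀ G ∈ approxSymmetries p M E Ω Δ, ∀ H ∈ approxSymmetries p M E Ω Δ,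
      a • G + b • H ∈ approxSymmetries p M E Ω Δ := by
    rintro a b _ ⟨Ξ, hΞ, hΞs, rfl⟩ _ ⟨H, hH, hHs, rfl⟩
    exact ⟨_, hΞ.lincomb hH a b, hΞs.lincomb hM hE hE0 hΩ hΩM hΞ hH hHs a b,
      (Generator.expand_lincomb hM hE hE0 hΞ hH a b).symm⟩
  refine
    { zero_mem := ⟨0, Generator.isSmooth_zero M E, isApproxSymmetry_zero p Ω Δ,
        (Generator.expand_zero hM hE hE0).symm⟩
      add_mem := fun G hG H hH => by simpa using hlin 1 1 G hG H hH
      smul_mem := fun c G hG => by simpa using hlin c 0 G hG G hG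
      bracket_mem := ?_
      add_bracket := ?_
      bracket_add := ?_
      smul_bracket := ?_
      bracket_smul := ?_
      bracket_self := fun G _ => approxBracket_self G
      jacobi := ?_ }
  · rintro _ ⟨Ξ, hΞ, hΞs, rfl⟩ _ ⟨H, hH, hHs, rfl⟩
    exact ⟨_, hΞ.bracket hH hM hE,
      hΞs.bracket hM hE hE0 hΩ hΩM hΔ hrank hΞ hH hHs,
      approxBracket_expand hM hE hE0 hΞ hH⟩
  · rintro _ ⟨Ξ, hΞ, -, rfl⟩ _ ⟨H, hH, -, rfl⟩ _ ⟨K, hK, -, rfl⟩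
    simpa using approxBracket_lincomb_left hM hE hE0 hΞ hH hK 1 1
  · rintro _ ⟨K, hK, -, rfl⟩ _ ⟨Ξ, hΞ, -, rfl⟩ _ ⟨H, hH, -, rfl⟩
    simpa using approxBracket_lincomb_right hM hE hE0 hΞ hH hK 1 1
  · rintro c _ ⟨Ξ, hΞ, -, rfl⟩ _ ⟨K, hK, -, rfl⟩
    simpa using approxBracket_lincomb_left hM hE hE0 hΞ hΞ hK c 0
  · rintro c _ ⟨K, hK, -, rfl⟩ _ ⟨Ξ, hΞ, -, rfl⟩
    simpa using approxBracket_lincomb_right hM hE hE0 hΞ hΞ hK c 0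
  · rintro _ ⟨Ξ, hΞ, -, rfl⟩ _ ⟨H, hH, -, rfl⟩ _ ⟨K, hK, -, rfl⟩
    -- Jacobi follows from the Leibniz form and antisymmetry. To pull the sign out of the second
    -- slot, the inner bracket is first written as an expansion, for which linearity is available.
    have hneg : approxBracket (H.expand p M) (approxBracket (K.expand p M) (Ξ.expand p M)) =
        -approxBracket (H.expand p M) (approxBracket (Ξ.expand p M) (K.expand p M)) := by
      rw [approxBracket_swap (K.expand p M), approxBracket_expand hM hE hE0 hΞ hK]
      simpa using approxBracket_lincomb_right hM hE hE0 (hΞ.bracket hK hM hE)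
        (hΞ.bracket hK hM hE) hH (-1) 0
    rw [approxBracket_leibniz hM hE hE0 hΞ hH hK, hneg, approxBracket_swap (K.expand p M)]
    abel
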